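/- Let $d\ge 1$ be an integer, $0<s<1$, $p\ge 1$, and let $\alpha,\beta\in\mathbb{R}$ be such that $\alpha,\beta,\alpha+\beta\in(-sp,d)$. Define, for $0<r<1$, $$ \Phi_{d,s,p}(r)=\begin{cases} \left|\mathbb{S}^{d-2}\right|\displaystyle\int_{-1}^{1}\frac{(1-t^{2})^{\frac{d-3}{2}}}{(1-2tr+r^{2})^{\frac{d+sp}{2}}}\,dt, & d\ge 2,\\[2mm] (1-r)^{-1-sp}+(1+r)^{-1-sp}, & d=1, \end{cases} $$ where $|\mathbb{S}^{d-2}|$ is the surface measure of the unit sphere of $\mathbb{R}^{d-1}$ (so $|\mathbb{S}^0|=2$), and $$ \mathcal{C}=\int_{0}^{1}r^{sp-1}\left(r^{\alpha}+r^{\beta}\right)\left|1-r^{\frac{d-\alpha-\beta-sp}{p}}\right|^{p}\Phi_{d,s,p}(r)\,dr . $$ Then $\mathcal{C}<\infty$, and the inequality $$ \int_{\mathbb{R}^d}\int_{\mathbb{R}^d}\frac{|u(x)-u(y)|^{p}}{|x-y|^{d+sp}}\,|x|^{-\alpha}\,|y|^{-\beta}\,dy\,dx\;\ge\;\mathcal{C}\int_{\mathbb{R}^d}\frac{|u(x)|^{p}}{|x|^{sp+\alpha+\beta}}\,dx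 $$ (whose left-hand side may be $+\infty$) holds for all real- or complex-valued $u\in C_c(\mathbb{R}^d)$ if $sp+\alpha+\beta<d$, and for all real- or complex-valued $u\in C_c(\mathbb{R}^d\setminus\{0\})$ if $sp+\alpha+\beta>d$. In each of the two cases the constant $\mathcal{C}$ is optimal: it is the largest constant for which the inequality holds for all $u$ in the respective class. Here $C_c(\Omega)$ denotes the continuous functions with compact support contained in $\Omega$, extended by $0$ to $\mathbb{R}^d$. -/

import Mathlib

open MeasureTheory Set
open scoped ENNReal

namespace FracHardy

noncomputable section

/-- The surface measure `|𝕊^{n-1}|` of the unit sphere of `ℝⁿ`. -/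
def sphereArea (n : ℕ) : ℝ≥0∞ :=
  (volume : Measure (EuclideanSpace ℝ (Fin n))).toSphere univ

/-- The function `Φ_{d,s,p}`, as an integral of a nonnegative function (for `d ≥ 2`). -/
def Phi (d : ℕ) (s p r : ℝ) : ℝ≥0∞ :=
  if 2 ≤ d then
    sphereArea (d - 1) *
      ∫⁻ t in Ioo (-1 : ℝ) 1,
        ENNReal.ofReal ((1 - t ^ 2) ^ (((d : ℝ) - 3) / 2) /
          (1 - 2 * t * r + r ^ 2) ^ (((d : ℝ) + s * p) / 2))
  else
    ENNReal.ofReal ((1 - r) ^ (-1 - s * p) + (1 + r) ^ (-1 - s * p))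

/-- The constant `𝒞(d,s,p,α,β)`, as an integral of a nonnegative function. -/
def hardyConst (d : ℕ) (s p α β : ℝ) : ℝ≥0∞ :=
  ∫⁻ r in Ioo (0 : ℝ) 1,
    ENNReal.ofReal (r ^ (s * p - 1) * (r ^ α + r ^ β) *
      |1 - r ^ (((d : ℝ) - α - β - s * p) / p)| ^ p) * Phi d s p r

/-- The weighted Gagliardo energy (possibly infinite). -/
def energy {𝕜 : Type*} [RCLike 𝕜] (d : ℕ) (s p α β : ℝ)
    (u : EuclideanSpace ℝ (Fin d) → 𝕜) : ℝ≥0∞ :=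
  ∫⁻ x, ∫⁻ y, ENNReal.ofReal
    (‖u x - u y‖ ^ p / ‖x - y‖ ^ ((d : ℝ) + s * p) * ‖x‖ ^ (-α) * ‖y‖ ^ (-β))

/-- The Hardy integral `∫ |u(x)|^p |x|^{-(sp+α+β)} dx`. -/
def hardyIntegral {𝕜 : Type*} [RCLike 𝕜] (d : ℕ) (s p α β : ℝ)
    (u : EuclideanSpace ℝ (Fin d) → 𝕜) : ℝ≥0∞ :=
  ∫⁻ x, ENNReal.ofReal (‖u x‖ ^ p / ‖x‖ ^ (s * p + α + β))

end

end FracHardy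

namespace FracHardy

/-! Put `γ = (d - α - β - sp) / p` and `w(x) = |x|^{-γ}`, the virtual extremal: only the divergence
of its integrals at `0` and `∞` keeps it from giving equality. Symmetrizing folds the energy onto
`|x| < |y|`, where `q = w(y) / w(x) = r^γ` depends on `r = |x| / |y|` alone. By polar coordinates
and scaling, the integral of `F(x) g(r)` or of `F(y) g(r)` against the kernel factors into a
weighted integral of `F` times a radial integral of `g`; having `F` at `y` instead of `x` costs a
factor `q^p` (`lintegral_symKernel_left`, `lintegral_symKernel_right`).

For the inequality, convexity of `t ↦ t^p` bounds `|a - b|^p` below by `|1 - q|^{p-1} (|a|^p -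
q^{1-p} |b|^p)` if `q < 1`, and by the same expression with the bracket negated if `q > 1`; `b = q
a` gives equality. With `a = u(x)` and `b = u(y)`, integration turns the bracket into `±(1 - q^{1-p}
q^p) = |1 - q|`, and `𝒞` times the Hardy integral comes out. The two halves of the bracket can
diverge separately at `r = 1`, so `truncated_hardy` works on `|1 - q| > δ`, and `δ → 0` follows by
monotone convergence.

For optimality, `w` is multiplied by a tent of width `L` in `log |x|`. The Hardy integral then grows
at least like `L`. The energy exceeds almost `𝒞` times it by at most `L` times an integral that
tends to `0`, since the tent is `1/L`-Lipschitz in `log |x|` (`energy_testFun_le`,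
`tendsto_cutoffIntegral`). The test functions vanish near the origin, so they serve both classes. -/

/-! ### Polar coordinates adapted to one distinguished direction. -/

/-- Polar coordinates for the integral of a nonnegative radial function. -/
theorem lintegral_fun_norm {E : Type*} [NormedAddCommGroup E] [NormedSpace ℝ E]
    [MeasurableSpace E] [BorelSpace E] [FiniteDimensional ℝ E] [Nontrivial E]
    (μ : Measure E) [μ.IsAddHaarMeasure] {f : ℝ → ℝ≥0∞} (hf : Measurable f) :
    ∫⁻ x, f ‖x‖ ∂μ = μ.toSphere univ *
      ∫⁻ r in Ioi (0 : ℝ), ENNReal.ofReal (r ^ (Module.finrank ℝ E - 1)) * f r := by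
  calc
    ∫⁻ x, f ‖x‖ ∂μ = ∫⁻ x : ({(0)}ᶜ : Set E), f ‖x.1‖ ∂(μ.comap (↑)) := by
      rw [lintegral_subtype_comap (measurableSet_singleton _).compl fun x ↦ f ‖x‖,
        restrict_compl_singleton]
    _ = ∫⁻ x, f x.2 ∂μ.toSphere.prod (.volumeIoiPow (Module.finrank ℝ E - 1)) := by
      simpa using μ.measurePreserving_homeomorphUnitSphereProd.lintegral_comp_emb
        (Homeomorph.measurableEmbedding _) (fun x ↦ f x.2)
    _ = μ.toSphere univ * ∫⁻ x : Ioi (0 : ℝ), f x ∂.volumeIoiPow (Module.finrank ℝ E - 1) := by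
      rw [lintegral_prod _ (by fun_prop)]
      simp [mul_comm]
    _ = _ := by
      rw [Measure.volumeIoiPow, lintegral_withDensity_eq_lintegral_mul _ (by fun_prop) (by fun_prop)]
      simp only [Pi.mul_apply]
      rw [lintegral_subtype_comap measurableSet_Ioi
        fun a ↦ ENNReal.ofReal (a ^ (Module.finrank ℝ E - 1)) * f a]

/-- Polar coordinates in the upper half-plane, with the cosine of the angle as a coordinate. -/
theorem lintegral_upper_half_plane {G : ℝ × ℝ → ℝ≥0∞} (hG : Measurable G) :
    ∫⁻ y, ∫⁻ σ in Ioi (0 : ℝ), G (y, σ) =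
      ∫⁻ ρ in Ioi (0 : ℝ), ∫⁻ t in Ioo (-1 : ℝ) 1,
        ENNReal.ofReal (ρ / √(1 - t ^ 2)) * G (ρ * t, ρ * √(1 - t ^ 2)) := by
  -- Substitution `t = cos θ` on `(0, π)`, where `√(1 - t²) = sin θ` cancels the Jacobian; the
  -- indicator of the upper half-plane removes the angles in `(-π, 0]`.
  have hangle : ∀ ρ : ℝ, 0 < ρ → ∫⁻ θ in Ioo (-Real.pi) Real.pi,
      ENNReal.ofReal ρ * (univ ×ˢ Ioi (0 : ℝ)).indicator G (ρ * Real.cos θ, ρ * Real.sin θ) =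
      ∫⁻ t in Ioo (-1 : ℝ) 1,
        ENNReal.ofReal (ρ / √(1 - t ^ 2)) * G (ρ * t, ρ * √(1 - t ^ 2)) := by
    intro ρ hρ
    have himg : Real.cos '' Ioo 0 Real.pi = Ioo (-1) 1 := by
      ext t
      constructor
      · rintro ⟨θ, hθ, rfl⟩
        have h1 := Real.strictAntiOn_cos ⟨le_rfl, Real.pi_pos.le⟩ ⟨hθ.1.le, hθ.2.le⟩ hθ.1
        have h2 := Real.strictAntiOn_cos ⟨hθ.1.le, hθ.2.le⟩ ⟨Real.pi_pos.le, le_rfl⟩ hθ.2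
        simp at h1 h2
        exact ⟨h2, h1⟩
      · intro ht
        exact ⟨Real.arccos t, ⟨Real.arccos_pos.2 ht.2, by
          rw [lt_iff_le_and_ne]
          refine ⟨Real.arccos_le_pi t, fun h ↦ ?_⟩
          rw [Real.arccos_eq_pi] at h
          exact absurd ht.1 (not_lt.2 h)⟩, Real.cos_arccos ht.1.le ht.2.le⟩
    rw [← himg, lintegral_image_eq_lintegral_abs_deriv_mul measurableSet_Ioo
      (fun θ _ ↦ (Real.hasDerivAt_cos θ).hasDerivWithinAt)
      (Real.injOn_cos.mono Ioo_subset_Icc_self)]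
    have hsub : Ioo 0 Real.pi ⊆ Ioo (-Real.pi) Real.pi :=
      Ioo_subset_Ioo_left (by linarith [Real.pi_pos])
    rw [← inter_eq_self_of_subset_left hsub,
      ← setLIntegral_indicator (measurableSet_Ioo (a := (0 : ℝ)) (b := Real.pi))]
    refine setLIntegral_congr_fun measurableSet_Ioo fun θ hθ ↦ ?_
    by_cases h0 : 0 < θ
    · have hs : 0 < Real.sin θ := Real.sin_pos_of_pos_of_lt_pi h0 hθ.2
      have hsq : √(1 - Real.cos θ ^ 2) = Real.sin θ := by
        rw [← Real.sin_sq, Real.sqrt_sq hs.le]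
      rw [indicator_of_mem (show θ ∈ Ioo 0 Real.pi from ⟨h0, hθ.2⟩),
        indicator_of_mem (by simp [hρ, hs]), hsq, ← mul_assoc, abs_neg, abs_of_pos hs,
        ← ENNReal.ofReal_mul hs.le, mul_div_cancel₀ _ hs.ne']
    · have hs : Real.sin θ ≤ 0 :=
        Real.sin_nonpos_of_nonpos_of_neg_pi_le (not_lt.1 h0) hθ.1.le
      have hs' := mul_nonpos_of_nonneg_of_nonpos hρ.le hs
      rw [indicator_of_notMem (by simp [hs']), indicator_of_notMem (by simp [h0]), mul_zero]
  have hm : Measurable ((univ ×ˢ Ioi (0 : ℝ)).indicator G) :=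
    hG.indicator (MeasurableSet.univ.prod measurableSet_Ioi)
  have h1 : ∫⁻ y, ∫⁻ σ in Ioi (0 : ℝ), G (y, σ) =
      ∫⁻ z : ℝ × ℝ, (univ ×ˢ Ioi (0 : ℝ)).indicator G z := by
    rw [Measure.volume_eq_prod, lintegral_prod _ hm.aemeasurable]
    refine lintegral_congr fun y ↦ ?_
    rw [← lintegral_indicator measurableSet_Ioi]
    refine lintegral_congr fun σ ↦ ?_
    by_cases h : 0 < σ <;> simp [indicator, h]
  rw [h1, ← lintegral_comp_polarCoord_symm, polarCoord_target, Measure.volume_eq_prod,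
    ← Measure.prod_restrict, lintegral_prod]
  · refine setLIntegral_congr_fun measurableSet_Ioi fun ρ hρ ↦ ?_
    rw [← hangle ρ hρ]
    simp
  · refine Measurable.aemeasurable ?_
    simp only [polarCoord_symm_apply, smul_eq_mul]
    exact (by fun_prop : Measurable fun x : ℝ × ℝ ↦ ENNReal.ofReal x.1).mul
      (hm.comp (by fun_prop))

/-- The first coordinate and the remaining ones as a pair. -/
theorem lintegral_euclidean_succ (n : ℕ) {H : ℝ → ℝ → ℝ≥0∞}
    (hH : Measurable (Function.uncurry H)) :
    ∫⁻ y : EuclideanSpace ℝ (Fin (n + 1)), H ‖y‖ (y 0) =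
      ∫⁻ t : ℝ, ∫⁻ z : EuclideanSpace ℝ (Fin n), H (√(t ^ 2 + ‖z‖ ^ 2)) t := by
  have hnorm : ∀ (m : ℕ) (v : Fin m → ℝ), ‖WithLp.toLp 2 v‖ = √(∑ i, v i ^ 2) := by
    intro m v
    rw [EuclideanSpace.norm_eq]
    simp
  calc
    _ = ∫⁻ v : Fin (n + 1) → ℝ, H (√(∑ i, v i ^ 2)) (v 0) := by
      rw [← (PiLp.volume_preserving_toLp (Fin (n + 1))).lintegral_comp_emb
        (MeasurableEquiv.toLp 2 (Fin (n + 1) → ℝ)).measurableEmbedding]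
      simp [hnorm]
    _ = ∫⁻ w : ℝ × (Fin n → ℝ), H (√(w.1 ^ 2 + ∑ i, w.2 i ^ 2)) w.1 := by
      rw [← (volume_preserving_piFinSuccAbove (fun _ : Fin (n + 1) ↦ ℝ) 0).symm.lintegral_comp_emb
        (MeasurableEquiv.measurableEmbedding _)]
      simp [Fin.sum_univ_succ, MeasurableEquiv.piFinSuccAbove_symm_apply]
    _ = ∫⁻ t : ℝ, ∫⁻ z : Fin n → ℝ, H (√(t ^ 2 + ∑ i, z i ^ 2)) t := by
      rw [Measure.volume_eq_prod, lintegral_prod]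
      exact (hH.comp (by fun_prop : Measurable fun w : ℝ × (Fin n → ℝ) ↦
        (√(w.1 ^ 2 + ∑ i, w.2 i ^ 2), w.1))).aemeasurable
    _ = _ := by
      refine lintegral_congr fun t ↦ ?_
      rw [← (PiLp.volume_preserving_toLp (Fin n)).lintegral_comp_emb
        (MeasurableEquiv.toLp 2 (Fin n → ℝ)).measurableEmbedding]
      refine lintegral_congr fun z ↦ ?_
      rw [hnorm, Real.sq_sqrt (by positivity)]

/-- Integration of a function of the norm and of one coordinate, in dimension at least two. -/
theorem lintegral_norm_coord (n : ℕ) {H : ℝ → ℝ → ℝ≥0∞}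
    (hH : Measurable (Function.uncurry H)) :
    ∫⁻ y : EuclideanSpace ℝ (Fin (n + 2)), H ‖y‖ (y 0) =
      sphereArea (n + 1) * ∫⁻ ρ in Ioi (0 : ℝ), ENNReal.ofReal (ρ ^ (n + 1)) *
        ∫⁻ t in Ioo (-1 : ℝ) 1,
          ENNReal.ofReal ((1 - t ^ 2) ^ (((n : ℝ) - 1) / 2)) * H ρ (ρ * t) := by
  have hfr : Module.finrank ℝ (EuclideanSpace ℝ (Fin (n + 1))) - 1 = n := by simp
  have hmeas : ∀ t, Measurable fun σ : ℝ ↦ H (√(t ^ 2 + σ ^ 2)) t := fun t ↦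
    hH.comp (by fun_prop : Measurable fun σ : ℝ ↦ (√(t ^ 2 + σ ^ 2), t))
  have hmeas2 : Measurable fun z : ℝ × ℝ ↦
      ENNReal.ofReal (z.2 ^ n) * H (√(z.1 ^ 2 + z.2 ^ 2)) z.1 :=
    (by fun_prop : Measurable fun z : ℝ × ℝ ↦ ENNReal.ofReal (z.2 ^ n)).mul
      (hH.comp (by fun_prop : Measurable fun z : ℝ × ℝ ↦ (√(z.1 ^ 2 + z.2 ^ 2), z.1)))
  rw [lintegral_euclidean_succ (n + 1) hH]
  simp_rw [fun t ↦ lintegral_fun_norm (volume : Measure (EuclideanSpace ℝ (Fin (n + 1))))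
    (hmeas t), hfr]
  rw [lintegral_const_mul' _ _ (measure_ne_top _ _)]
  congr 1
  rw [lintegral_upper_half_plane hmeas2]
  refine setLIntegral_congr_fun measurableSet_Ioi fun ρ (hρ : 0 < ρ) ↦ ?_
  rw [← lintegral_const_mul' _ _ ENNReal.ofReal_ne_top]
  refine setLIntegral_congr_fun measurableSet_Ioo fun t ht ↦ ?_
  have h1 : 0 < 1 - t ^ 2 := by nlinarith [ht.1, ht.2]
  have h2 : √((ρ * t) ^ 2 + (ρ * √(1 - t ^ 2)) ^ 2) = ρ := by
    rw [mul_pow, mul_pow, Real.sq_sqrt h1.le, ← mul_add, add_sub_cancel, mul_one,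
      Real.sqrt_sq hρ.le]
  simp only [h2]
  rw [← mul_assoc, ← mul_assoc, ← ENNReal.ofReal_mul (by positivity),
    ← ENNReal.ofReal_mul (by positivity)]
  congr 2
  -- The exponent `(n - 1) / 2` collects `√(1 - t²)^n` from the radius in the hyperplane and `1 /
  -- √(1 - t²)` from the change of variables.
  rw [Real.sqrt_eq_rpow, mul_pow, ← Real.rpow_natCast (_ ^ _) n, ← Real.rpow_mul h1.le,
    show ((n : ℝ) - 1) / 2 = 1 / 2 * n - 1 / 2 by ring, Real.rpow_sub h1]
  ring

/-! ### The function `Φ` as a spherical integral of the kernel. -/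

/-- The integral of `|e - rω|^{-d-sp}` over the unit sphere, for all radii `r > 0`. -/
noncomputable def PhiExt (d : ℕ) (s p r : ℝ) : ℝ≥0∞ :=
  if 2 ≤ d then Phi d s p r
  else ENNReal.ofReal (|1 - r| ^ (-1 - s * p) + |1 + r| ^ (-1 - s * p))

theorem PhiExt_of_lt_one {d : ℕ} {s p r : ℝ} (h0 : 0 < r) (h1 : r < 1) :
    PhiExt d s p r = Phi d s p r := by
  unfold PhiExt
  split_ifs with h
  · rfl
  · rw [Phi, if_neg h, abs_of_pos (by linarith), abs_of_pos (by linarith)]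

theorem quad_pos {t r : ℝ} (ht : t ∈ Ioo (-1 : ℝ) 1) : 0 < 1 - 2 * t * r + r ^ 2 := by
  nlinarith [sq_nonneg (r - t), ht.1, ht.2]

/-- For unit vectors, `|e - r⁻¹ω| = |re - ω| / r` and `|re - ω| = |e - rω|`. This brings radii
greater than one back to `(0, 1)`. -/
theorem PhiExt_inv {d : ℕ} (hd : 1 ≤ d) {s p r : ℝ} (h0 : 0 < r) (h1 : r < 1) :
    PhiExt d s p r⁻¹ = ENNReal.ofReal (r ^ ((d : ℝ) + s * p)) * Phi d s p r := by
  unfold PhiExt Phi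
  split_ifs with h
  · rw [mul_left_comm, ← lintegral_const_mul' _ _ ENNReal.ofReal_ne_top]
    congr 1
    refine setLIntegral_congr_fun measurableSet_Ioo fun t ht ↦ ?_
    rw [← ENNReal.ofReal_mul (by positivity)]
    congr 1
    have hq := quad_pos (r := r) ht
    have h2 : 1 - 2 * t * r⁻¹ + r⁻¹ ^ 2 = (1 - 2 * t * r + r ^ 2) / r ^ 2 := by
      field_simp
      ring
    rw [h2, Real.div_rpow hq.le (by positivity), ← Real.rpow_natCast r 2, ← Real.rpow_mul h0.le]
    rw [show ((2 : ℕ) : ℝ) * ((d + s * p) / 2) = d + s * p by push_cast; ring]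
    have := (Real.rpow_pos_of_pos h0 (d + s * p)).ne'
    field_simp
  · obtain rfl : d = 1 := by omega
    rw [← ENNReal.ofReal_mul (by positivity)]
    congr 1
    have e1 : |1 - r⁻¹| = (1 - r) / r := by
      rw [abs_of_neg (by linarith [(one_lt_inv₀ h0).2 h1])]
      field_simp
      ring
    have e2 : |1 + r⁻¹| = (1 + r) / r := by
      rw [abs_of_pos (by positivity)]
      field_simp
      ring
    rw [e1, e2, Real.div_rpow (by linarith) h0.le, Real.div_rpow (by linarith) h0.le,
      show -1 - s * p = -(((1 : ℕ) : ℝ) + s * p) by push_cast; ring, Real.rpow_neg h0.le]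
    field_simp

theorem measurable_Phi (d : ℕ) (s p : ℝ) : Measurable (Phi d s p) := by
  unfold Phi
  split_ifs with h
  · refine Measurable.const_mul ?_ _
    refine Measurable.lintegral_prod_right ?_
    fun_prop
  · fun_prop

/-- A radial function integrated against a power of the distance to a unit vector. -/
theorem lintegral_radial_mul_dist_rpow {d : ℕ} (hd : 1 ≤ d) (s p : ℝ)
    {e : EuclideanSpace ℝ (Fin d)} (he : ‖e‖ = 1) {g : ℝ → ℝ≥0∞} (hg : Measurable g) :
    ∫⁻ y, g ‖y‖ * ENNReal.ofReal (‖e - y‖ ^ (-((d : ℝ) + s * p))) =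
      ∫⁻ r in Ioi (0 : ℝ), g r * (ENNReal.ofReal (r ^ ((d : ℝ) - 1)) * PhiExt d s p r) := by
  obtain ⟨m, rfl⟩ : ∃ m, d = m + 1 := ⟨d - 1, by omega⟩
  -- In an orthonormal basis with `e` as its first vector, `|e - y|² = 1 - 2 y₀ + |y|²` involves
  -- only the norm and the first coordinate.
  obtain ⟨b, hb⟩ := Orthonormal.exists_orthonormalBasis_extension_of_card_eq (𝕜 := ℝ)
    (E := EuclideanSpace ℝ (Fin (m + 1))) (ι := Fin (m + 1)) (by simp)
    (v := fun _ ↦ e) (s := {0}) (by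
      rw [orthonormal_iff_ite]
      rintro ⟨i, rfl⟩ ⟨j, rfl⟩
      simp [he])
  have hb0 : b 0 = e := hb 0 rfl
  set H : ℝ → ℝ → ℝ≥0∞ := fun ρ τ ↦
    g ρ * ENNReal.ofReal ((1 - 2 * τ + ρ ^ 2) ^ (-(((m + 1 : ℕ) : ℝ) + s * p) / 2)) with hHdef
  have hH : Measurable (Function.uncurry H) := by
    simp only [hHdef, Function.uncurry_def]
    fun_prop
  have hrot : ∫⁻ y, g ‖y‖ * ENNReal.ofReal (‖e - y‖ ^ (-(((m + 1 : ℕ) : ℝ) + s * p))) =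
      ∫⁻ y : EuclideanSpace ℝ (Fin (m + 1)), H ‖y‖ (y 0) := by
    rw [← b.measurePreserving_repr.lintegral_comp_emb
      b.repr.toHomeomorph.measurableEmbedding (fun y ↦ H ‖y‖ (y 0))]
    refine lintegral_congr fun y ↦ ?_
    have h1 : ‖e - y‖ ^ 2 = 1 - 2 * b.repr y 0 + ‖y‖ ^ 2 := by
      rw [norm_sub_sq_real, he, b.repr_apply_apply, hb0]
      ring
    rw [hHdef]
    simp only [LinearIsometryEquiv.norm_map]
    rw [← h1, ← Real.rpow_natCast (‖e - y‖) 2, ← Real.rpow_mul (norm_nonneg _)]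
    congr 4
    push_cast
    ring
  rw [hrot]
  rcases m with _ | n
  -- In dimension one the complementary space is a point, and folding the negative half-line onto
  -- the positive one produces the two terms of `Φ`.
  · rw [lintegral_euclidean_succ 0 hH]
    simp only [volume_euclideanSpace_eq_dirac, lintegral_dirac]
    have hneg : ∫⁻ t in Iic (0 : ℝ), H (√(t ^ 2 + ‖(0 : EuclideanSpace ℝ (Fin 0))‖ ^ 2)) t =
        ∫⁻ t in Ioi (0 : ℝ), H (√(t ^ 2 + ‖(0 : EuclideanSpace ℝ (Fin 0))‖ ^ 2)) (-t) := by
      rw [← Measure.restrict_congr_set Iio_ae_eq_Iic,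
        ← (Measure.measurePreserving_neg (volume : Measure ℝ)).setLIntegral_comp_preimage_emb
          (Homeomorph.neg ℝ).measurableEmbedding]
      simp
    rw [← lintegral_add_compl _ (measurableSet_Ioi (a := (0 : ℝ))), compl_Ioi, hneg,
      ← lintegral_add_left (by
        exact hH.comp (by fun_prop : Measurable fun t : ℝ ↦
          (√(t ^ 2 + ‖(0 : EuclideanSpace ℝ (Fin 0))‖ ^ 2), t)))]
    refine setLIntegral_congr_fun measurableSet_Ioi fun t (ht : 0 < t) ↦ ?_
    have hsq : √(t ^ 2 + ‖(0 : EuclideanSpace ℝ (Fin 0))‖ ^ 2) = t := by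
      rw [norm_zero, zero_pow two_ne_zero, add_zero, Real.sqrt_sq ht.le]
    have hpow : ∀ a : ℝ, (a ^ 2) ^ (-(((0 + 1 : ℕ) : ℝ) + s * p) / 2) = |a| ^ (-1 - s * p) := by
      intro a
      rw [← sq_abs, ← Real.rpow_natCast, ← Real.rpow_mul (abs_nonneg a)]
      congr 1
      push_cast
      ring
    simp only [hsq, hHdef, PhiExt]
    rw [if_neg (by omega), show 1 - 2 * t + t ^ 2 = (1 - t) ^ 2 by ring,
      show 1 - 2 * -t + t ^ 2 = (1 + t) ^ 2 by ring, hpow, hpow, ← mul_add,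
      ← ENNReal.ofReal_add (by positivity) (by positivity)]
    simp
  · rw [lintegral_norm_coord n hH, ← lintegral_const_mul' _ _
      (show sphereArea (n + 1) ≠ ∞ from measure_ne_top _ _)]
    refine setLIntegral_congr_fun measurableSet_Ioi fun ρ (hρ : 0 < ρ) ↦ ?_
    simp only [PhiExt, Phi]
    rw [if_pos (by omega), if_pos (by omega)]
    have h2 : ENNReal.ofReal (ρ ^ (((n + 1 + 1 : ℕ) : ℝ) - 1)) = ENNReal.ofReal (ρ ^ (n + 1)) := by
      rw [← Real.rpow_natCast]
      congr 2
      push_cast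
      ring
    have h3 : ∫⁻ t in Ioo (-1 : ℝ) 1,
          ENNReal.ofReal ((1 - t ^ 2) ^ (((n : ℝ) - 1) / 2)) * H ρ (ρ * t) =
        g ρ * ∫⁻ t in Ioo (-1 : ℝ) 1,
          ENNReal.ofReal ((1 - t ^ 2) ^ ((((n + 1 + 1 : ℕ) : ℝ) - 3) / 2) /
          (1 - 2 * t * ρ + ρ ^ 2) ^ ((((n + 1 + 1 : ℕ) : ℝ) + s * p) / 2)) := by
      rw [← lintegral_const_mul _ (by fun_prop)]
      refine setLIntegral_congr_fun measurableSet_Ioo fun t ht ↦ ?_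
      have h1 : 0 < 1 - t ^ 2 := by nlinarith [ht.1, ht.2]
      simp only [hHdef]
      rw [mul_left_comm, ← ENNReal.ofReal_mul (by positivity),
        div_eq_mul_inv (_ ^ _) (_ ^ _), ← Real.rpow_neg (quad_pos ht).le]
      congr 3
      · congr 1
        push_cast
        ring
      · congr 1 <;> ring
    rw [h2, h3]
    simp only [Nat.add_sub_cancel]
    ring

/-! ### Scaling: integrals of functions of `|x| / |y|` against the kernel. -/

/-- Dilation of a nonnegative integral. -/
theorem lintegral_comp_smul_pos {d : ℕ} {R : ℝ} (hR : 0 < R)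
    (f : EuclideanSpace ℝ (Fin d) → ℝ≥0∞) :
    ∫⁻ y, f y = ENNReal.ofReal (R ^ (d : ℝ)) * ∫⁻ y, f (R • y) := by
  have h := Measure.map_addHaar_smul (volume : Measure (EuclideanSpace ℝ (Fin d))) hR.ne'
  have hemb : MeasurableEmbedding fun y : EuclideanSpace ℝ (Fin d) ↦ R • y :=
    (Homeomorph.smulOfNeZero R hR.ne').measurableEmbedding
  rw [← hemb.lintegral_map (μ := volume), h, lintegral_smul_measure, smul_eq_mul, ← mul_assoc,
    ← ENNReal.ofReal_mul (by positivity), finrank_euclideanSpace_fin, abs_of_pos (by positivity),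
    Real.rpow_natCast, mul_inv_cancel₀ (by positivity), ENNReal.ofReal_one, one_mul]

theorem norm_smul_sub_rpow {E : Type*} [NormedAddCommGroup E] [NormedSpace ℝ E] {R : ℝ}
    (hR : 0 < R) (e y : E) (a : ℝ) : ‖R • e - R • y‖ ^ a = R ^ a * ‖e - y‖ ^ a := by
  rw [← smul_sub, norm_smul, Real.norm_of_nonneg hR.le, Real.mul_rpow hR.le (norm_nonneg _)]

theorem exists_pos_smul_unit {E : Type*} [NormedAddCommGroup E] [NormedSpace ℝ E] {x : E}
    (hx : x ≠ 0) : ∃ (R : ℝ) (e : E), 0 < R ∧ ‖e‖ = 1 ∧ x = R • e := by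
  have hR : 0 < ‖x‖ := norm_pos_iff.2 hx
  exact ⟨‖x‖, ‖x‖⁻¹ • x, hR, by rw [norm_smul, norm_inv, norm_norm, inv_mul_cancel₀ hR.ne'], by
    rw [smul_smul, mul_inv_cancel₀ hR.ne', one_smul]⟩

/-- Integration of a function of `|x|/|y|` against the kernel over `|x| < |y|`. -/
theorem setLIntegral_norm_lt_kernel_right {d : ℕ} (hd : 1 ≤ d) (s p : ℝ)
    {x : EuclideanSpace ℝ (Fin d)} (hx : x ≠ 0) {g : ℝ → ℝ≥0∞} (hg : Measurable g) :
    ∫⁻ y in {y | ‖x‖ < ‖y‖}, g (‖x‖ / ‖y‖) * ENNReal.ofReal (‖x - y‖ ^ (-((d : ℝ) + s * p))) =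
      ENNReal.ofReal (‖x‖ ^ (-(s * p))) *
        ∫⁻ r in Ioo (0 : ℝ) 1, g r * (ENNReal.ofReal (r ^ (s * p - 1)) * Phi d s p r) := by
  obtain ⟨R, e, hR, he, rfl⟩ := exists_pos_smul_unit hx
  have hRe : ‖R • e‖ = R := by rw [norm_smul, he, mul_one, Real.norm_of_nonneg hR.le]
  simp only [hRe]
  have hset : MeasurableSet {y : EuclideanSpace ℝ (Fin d) | R < ‖y‖} :=
    measurableSet_lt measurable_const measurable_norm
  rw [← lintegral_indicator hset, lintegral_comp_smul_pos hR]
  have h1 : ∀ y : EuclideanSpace ℝ (Fin d), ({y | R < ‖y‖} : Set _).indicator (fun y ↦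
      g (R / ‖y‖) * ENNReal.ofReal (‖R • e - y‖ ^ (-((d : ℝ) + s * p)))) (R • y) =
      ENNReal.ofReal (R ^ (-((d : ℝ) + s * p))) * ((Ioi (1 : ℝ)).indicator (fun ρ ↦ g ρ⁻¹) ‖y‖ *
        ENNReal.ofReal (‖e - y‖ ^ (-((d : ℝ) + s * p)))) := by
    intro y
    simp only [indicator, mem_ofPred_eq, mem_Ioi, norm_smul, Real.norm_of_nonneg hR.le]
    by_cases hy : 1 < ‖y‖
    · rw [if_pos hy, if_pos (by nlinarith), norm_smul_sub_rpow hR,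
        ENNReal.ofReal_mul (by positivity), div_mul_cancel_left₀ hR.ne']
      ring
    · rw [if_neg hy, if_neg (by nlinarith)]
      simp
  simp_rw [h1]
  have hg' : Measurable ((Ioi (1 : ℝ)).indicator fun ρ ↦ g ρ⁻¹) :=
    (hg.comp measurable_inv).indicator measurableSet_Ioi
  rw [lintegral_const_mul' _ _ ENNReal.ofReal_ne_top, lintegral_radial_mul_dist_rpow hd s p he
    hg', ← mul_assoc,
    ← ENNReal.ofReal_mul (by positivity), ← Real.rpow_add hR]
  congr 1
  · congr 2
    ring
  -- After scaling to `|x| = 1` the radius is `|y| = 1 / r`. The factors `r^{-2}` (Jacobian),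
  -- `r^{-(d-1)}` and `r^{d+sp}` (from `PhiExt_inv`) combine to `r^{sp-1}`.
  have hinv : Ioi (1 : ℝ) = (fun r : ℝ ↦ r⁻¹) '' Ioo 0 1 := by
    rw [image_inv_eq_inv, inv_Ioo_0_left one_pos, inv_one]
  have h2 : ∫⁻ r in Ioi (0 : ℝ), (Ioi (1 : ℝ)).indicator (fun ρ ↦ g ρ⁻¹) r *
      (ENNReal.ofReal (r ^ ((d : ℝ) - 1)) * PhiExt d s p r) =
      ∫⁻ r in Ioi (1 : ℝ), g r⁻¹ * (ENNReal.ofReal (r ^ ((d : ℝ) - 1)) * PhiExt d s p r) := by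
    conv_rhs => rw [← inter_eq_self_of_subset_left (Ioi_subset_Ioi (zero_le_one' ℝ))]
    rw [← setLIntegral_indicator measurableSet_Ioi]
    refine lintegral_congr fun r ↦ ?_
    by_cases hr : r ∈ Ioi (1 : ℝ) <;> simp [hr]
  rw [h2, hinv, lintegral_image_eq_lintegral_abs_deriv_mul measurableSet_Ioo
    (fun r hr ↦ (hasDerivAt_inv (ne_of_gt hr.1)).hasDerivWithinAt)
    (inv_injective.injOn)]
  refine setLIntegral_congr_fun measurableSet_Ioo fun r hr ↦ ?_
  have hr0 := hr.1
  simp only [inv_inv]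
  rw [PhiExt_inv hd hr.1 hr.2, mul_left_comm, ← mul_assoc (ENNReal.ofReal _),
    ← mul_assoc (_ * _) (ENNReal.ofReal _), ← ENNReal.ofReal_mul (by positivity),
    ← ENNReal.ofReal_mul (by positivity)]
  congr 3
  rw [abs_neg, abs_of_pos (by positivity), Real.inv_rpow hr0.le, ← Real.rpow_neg hr0.le,
    ← Real.rpow_natCast, ← Real.rpow_neg hr0.le, ← Real.rpow_add hr0, ← Real.rpow_add hr0]
  congr 1
  push_cast
  ring

/-- Integration of a function of `|x|/|y|` against the kernel over `|x| < |y|`. -/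
theorem setLIntegral_norm_lt_kernel_left {d : ℕ} (hd : 1 ≤ d) (s p : ℝ)
    {y : EuclideanSpace ℝ (Fin d)} (hy : y ≠ 0) {g : ℝ → ℝ≥0∞} (hg : Measurable g) :
    ∫⁻ x in {x | ‖x‖ < ‖y‖}, g (‖x‖ / ‖y‖) * ENNReal.ofReal (‖x - y‖ ^ (-((d : ℝ) + s * p))) =
      ENNReal.ofReal (‖y‖ ^ (-(s * p))) *
        ∫⁻ r in Ioo (0 : ℝ) 1, g r * (ENNReal.ofReal (r ^ ((d : ℝ) - 1)) * Phi d s p r) := by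
  obtain ⟨R, e, hR, he, rfl⟩ := exists_pos_smul_unit hy
  have hRe : ‖R • e‖ = R := by rw [norm_smul, he, mul_one, Real.norm_of_nonneg hR.le]
  simp only [hRe]
  have hset : MeasurableSet {x : EuclideanSpace ℝ (Fin d) | ‖x‖ < R} :=
    measurableSet_lt measurable_norm measurable_const
  rw [← lintegral_indicator hset, lintegral_comp_smul_pos hR]
  have h1 : ∀ x : EuclideanSpace ℝ (Fin d), ({x | ‖x‖ < R} : Set _).indicator (fun x ↦
      g (‖x‖ / R) * ENNReal.ofReal (‖x - R • e‖ ^ (-((d : ℝ) + s * p)))) (R • x) =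
      ENNReal.ofReal (R ^ (-((d : ℝ) + s * p))) * ((Iio (1 : ℝ)).indicator g ‖x‖ *
        ENNReal.ofReal (‖e - x‖ ^ (-((d : ℝ) + s * p)))) := by
    intro x
    simp only [indicator, mem_ofPred_eq, mem_Iio, norm_smul, Real.norm_of_nonneg hR.le]
    by_cases hx : ‖x‖ < 1
    · rw [if_pos hx, if_pos (by nlinarith), norm_smul_sub_rpow hR, norm_sub_rev x e,
        ENNReal.ofReal_mul (by positivity), mul_div_cancel_left₀ _ hR.ne']
      ring
    · rw [if_neg hx, if_neg (by nlinarith)]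
      simp
  simp_rw [h1]
  rw [lintegral_const_mul' _ _ ENNReal.ofReal_ne_top, lintegral_radial_mul_dist_rpow hd s p he
    (hg.indicator measurableSet_Iio), ← mul_assoc,
    ← ENNReal.ofReal_mul (by positivity), ← Real.rpow_add hR]
  congr 1
  · congr 2
    ring
  rw [← Iio_inter_Ioi.trans (rfl : Ioo (0 : ℝ) 1 = _), ← setLIntegral_indicator measurableSet_Iio]
  refine setLIntegral_congr_fun measurableSet_Ioi fun r (hr : 0 < r) ↦ ?_
  by_cases h : r < 1
  · simp [h, PhiExt_of_lt_one hr h]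
  · simp [h]

/-! ### Separation of variables on the region `|x| < |y|`. -/

/-- The integral over `(0, 1)` against the measure `r^{sp-1} (r^α + r^β) Φ(r) dr`. -/
noncomputable def radialIntegral (d : ℕ) (s p α β : ℝ) (g : ℝ → ℝ≥0∞) : ℝ≥0∞ :=
  ∫⁻ r in Ioo (0 : ℝ) 1,
    g r * (ENNReal.ofReal (r ^ (s * p - 1) * (r ^ α + r ^ β)) * Phi d s p r)

/-- The kernel of the energy, symmetrized. -/
noncomputable def symKernel (d : ℕ) (s p α β : ℝ) (x y : EuclideanSpace ℝ (Fin d)) : ℝ≥0∞ :=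
  ENNReal.ofReal (‖x‖ ^ (-α) * ‖y‖ ^ (-β) + ‖x‖ ^ (-β) * ‖y‖ ^ (-α)) *
    ENNReal.ofReal (‖x - y‖ ^ (-((d : ℝ) + s * p)))

theorem measurable_symKernel (d : ℕ) (s p α β : ℝ) :
    Measurable (Function.uncurry (symKernel d s p α β)) := by
  unfold symKernel Function.uncurry
  fun_prop

theorem measurableSet_norm_lt (d : ℕ) (x : EuclideanSpace ℝ (Fin d)) :
    MeasurableSet {y : EuclideanSpace ℝ (Fin d) | ‖x‖ < ‖y‖} :=
  measurableSet_lt measurable_const measurable_norm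

theorem measurableSet_lt_norm (d : ℕ) (y : EuclideanSpace ℝ (Fin d)) :
    MeasurableSet {x : EuclideanSpace ℝ (Fin d) | ‖x‖ < ‖y‖} :=
  measurableSet_lt measurable_norm measurable_const

theorem measurable_setLIntegral_norm_lt {d : ℕ}
    {f : EuclideanSpace ℝ (Fin d) → EuclideanSpace ℝ (Fin d) → ℝ≥0∞}
    (hf : Measurable (Function.uncurry f)) :
    Measurable fun x ↦ ∫⁻ y in {y | ‖x‖ < ‖y‖}, f x y := by
  have hset : MeasurableSet {z : EuclideanSpace ℝ (Fin d) × EuclideanSpace ℝ (Fin d) |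
      ‖z.1‖ < ‖z.2‖} := measurableSet_lt (by fun_prop) (by fun_prop)
  have h : ∀ x, ∫⁻ y in {y | ‖x‖ < ‖y‖}, f x y =
      ∫⁻ y, {z : EuclideanSpace ℝ (Fin d) × EuclideanSpace ℝ (Fin d) |
        ‖z.1‖ < ‖z.2‖}.indicator (Function.uncurry f) (x, y) := fun x ↦ by
    rw [← lintegral_indicator (measurableSet_norm_lt d x)]
    rfl
  simp_rw [h]
  exact (hf.indicator hset).lintegral_prod_right'

theorem lintegral_norm_lt_swap {d : ℕ}
    {f : EuclideanSpace ℝ (Fin d) → EuclideanSpace ℝ (Fin d) → ℝ≥0∞}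
    (hf : Measurable (Function.uncurry f)) :
    ∫⁻ x, ∫⁻ y in {y | ‖x‖ < ‖y‖}, f x y = ∫⁻ y, ∫⁻ x in {x | ‖x‖ < ‖y‖}, f x y := by
  have hset : MeasurableSet {z : EuclideanSpace ℝ (Fin d) × EuclideanSpace ℝ (Fin d) |
      ‖z.1‖ < ‖z.2‖} := measurableSet_lt (by fun_prop) (by fun_prop)
  have h : ∀ x, ∫⁻ y in {y | ‖x‖ < ‖y‖}, f x y =
      ∫⁻ y, {z : EuclideanSpace ℝ (Fin d) × EuclideanSpace ℝ (Fin d) |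
        ‖z.1‖ < ‖z.2‖}.indicator (Function.uncurry f) (x, y) := fun x ↦ by
    rw [← lintegral_indicator (measurableSet_norm_lt d x)]
    rfl
  have h' : ∀ y, ∫⁻ x in {x | ‖x‖ < ‖y‖}, f x y =
      ∫⁻ x, {z : EuclideanSpace ℝ (Fin d) × EuclideanSpace ℝ (Fin d) |
        ‖z.1‖ < ‖z.2‖}.indicator (Function.uncurry f) (x, y) := fun y ↦ by
    rw [← lintegral_indicator (measurableSet_lt_norm d y)]
    rfl
  simp_rw [h, h']
  exact lintegral_lintegral_swap (hf.indicator hset).aemeasurable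

/-- The weights are homogeneous of degree `-(α + β)`: once a power of `|x|` is pulled out, they
depend on the ratio of the norms only. `symKernel_eq_right` pulls out `|y|` instead. -/
theorem symKernel_eq_left {d : ℕ} (s p α β : ℝ) {x y : EuclideanSpace ℝ (Fin d)} (hx : x ≠ 0)
    (hy : y ≠ 0) : symKernel d s p α β x y = ENNReal.ofReal (‖x‖ ^ (-(α + β))) *
      (ENNReal.ofReal ((‖x‖ / ‖y‖) ^ α + (‖x‖ / ‖y‖) ^ β) *
        ENNReal.ofReal (‖x - y‖ ^ (-((d : ℝ) + s * p)))) := by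
  have hx' := norm_pos_iff.2 hx
  have hy' := norm_pos_iff.2 hy
  rw [symKernel, ← mul_assoc, ← ENNReal.ofReal_mul (p := ‖x‖ ^ (-(α + β))) (by positivity)]
  congr 2
  simp only [Real.div_rpow hx'.le hy'.le, Real.rpow_neg hx'.le, Real.rpow_neg hy'.le,
    Real.rpow_add hx']
  field_simp
  ring

theorem symKernel_eq_right {d : ℕ} (s p α β : ℝ) {x y : EuclideanSpace ℝ (Fin d)} (hx : x ≠ 0)
    (hy : y ≠ 0) : symKernel d s p α β x y = ENNReal.ofReal (‖y‖ ^ (-(α + β))) *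
      (ENNReal.ofReal ((‖x‖ / ‖y‖) ^ (-α) + (‖x‖ / ‖y‖) ^ (-β)) *
        ENNReal.ofReal (‖x - y‖ ^ (-((d : ℝ) + s * p)))) := by
  have hx' := norm_pos_iff.2 hx
  have hy' := norm_pos_iff.2 hy
  rw [symKernel, ← mul_assoc, ← ENNReal.ofReal_mul (p := ‖y‖ ^ (-(α + β))) (by positivity)]
  congr 2
  simp only [Real.div_rpow hx'.le hy'.le, Real.rpow_neg hx'.le, Real.rpow_neg hy'.le,
    Real.rpow_add hy']
  field_simp

theorem ae_ne_zero {d : ℕ} (hd : 1 ≤ d) :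
    ∀ᵐ x : EuclideanSpace ℝ (Fin d), x ≠ 0 := by
  have : Nonempty (Fin d) := ⟨⟨0, hd⟩⟩
  exact Measure.ae_ne volume 0

/-- Separation of variables in `x` and `r = |x|/|y|`. -/
theorem lintegral_symKernel_left {d : ℕ} (hd : 1 ≤ d) (s p α β : ℝ)
    {F : EuclideanSpace ℝ (Fin d) → ℝ≥0∞} (hF : Measurable F) {g : ℝ → ℝ≥0∞}
    (hg : Measurable g) :
    ∫⁻ x, ∫⁻ y in {y | ‖x‖ < ‖y‖}, F x * g (‖x‖ / ‖y‖) * symKernel d s p α β x y =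
      (∫⁻ x, F x * ENNReal.ofReal (‖x‖ ^ (-(s * p + α + β)))) *
        radialIntegral d s p α β g := by
  rw [← lintegral_mul_const _ (by fun_prop)]
  refine lintegral_congr_ae ?_
  filter_upwards [ae_ne_zero hd] with x hx
  have hx' := norm_pos_iff.2 hx
  have hm : Measurable fun r : ℝ ↦ g r * ENNReal.ofReal (r ^ α + r ^ β) := by fun_prop
  have h := setLIntegral_norm_lt_kernel_right hd s p hx hm
  calc
    _ = ∫⁻ y in {y | ‖x‖ < ‖y‖}, F x * ENNReal.ofReal (‖x‖ ^ (-(α + β))) *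
        (g (‖x‖ / ‖y‖) * ENNReal.ofReal ((‖x‖ / ‖y‖) ^ α + (‖x‖ / ‖y‖) ^ β) *
        ENNReal.ofReal (‖x - y‖ ^ (-((d : ℝ) + s * p)))) := by
      refine setLIntegral_congr_fun (measurableSet_norm_lt d x) fun y (hy : ‖x‖ < ‖y‖) ↦ ?_
      rw [symKernel_eq_left s p α β hx (norm_pos_iff.1 (hx'.trans hy))]
      ring
    _ = F x * ENNReal.ofReal (‖x‖ ^ (-(α + β))) * (ENNReal.ofReal (‖x‖ ^ (-(s * p))) *
        ∫⁻ r in Ioo (0 : ℝ) 1, g r * ENNReal.ofReal (r ^ α + r ^ β) *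
          (ENNReal.ofReal (r ^ (s * p - 1)) * Phi d s p r)) := by
      rw [← h, lintegral_const_mul _ (by fun_prop)]
    _ = _ := by
      rw [radialIntegral, ← mul_assoc, mul_assoc (F x), ← ENNReal.ofReal_mul (by positivity),
        ← Real.rpow_add hx']
      congr 1
      · congr 3
        ring
      refine setLIntegral_congr_fun measurableSet_Ioo fun r hr ↦ ?_
      have := hr.1
      rw [mul_comm (r ^ (s * p - 1)), ENNReal.ofReal_mul (by positivity)]
      ring

/-- Separation of variables in `y` and `r = |x|/|y|`. -/
theorem lintegral_symKernel_right {d : ℕ} (hd : 1 ≤ d) (s p α β : ℝ)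
    {F : EuclideanSpace ℝ (Fin d) → ℝ≥0∞} (hF : Measurable F) {g : ℝ → ℝ≥0∞}
    (hg : Measurable g) :
    ∫⁻ x, ∫⁻ y in {y | ‖x‖ < ‖y‖}, F y * g (‖x‖ / ‖y‖) * symKernel d s p α β x y =
      (∫⁻ x, F x * ENNReal.ofReal (‖x‖ ^ (-(s * p + α + β)))) *
        radialIntegral d s p α β fun r ↦ g r * ENNReal.ofReal (r ^ ((d : ℝ) - α - β - s * p)) := by
  have hK := measurable_symKernel d s p α β
  rw [lintegral_norm_lt_swap, ← lintegral_mul_const _ (by fun_prop)]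
  swap
  · exact (by fun_prop : Measurable fun z : EuclideanSpace ℝ (Fin d) × EuclideanSpace ℝ (Fin d) ↦
      F z.2 * g (‖z.1‖ / ‖z.2‖)).mul hK
  refine lintegral_congr_ae ?_
  filter_upwards [ae_ne_zero hd] with y hy
  have hy' := norm_pos_iff.2 hy
  have hm : Measurable fun r : ℝ ↦ g r * ENNReal.ofReal (r ^ (-α) + r ^ (-β)) := by fun_prop
  have h := setLIntegral_norm_lt_kernel_left hd s p hy hm
  calc
    _ = ∫⁻ x in {x | ‖x‖ < ‖y‖}, F y * ENNReal.ofReal (‖y‖ ^ (-(α + β))) *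
        (g (‖x‖ / ‖y‖) * ENNReal.ofReal ((‖x‖ / ‖y‖) ^ (-α) + (‖x‖ / ‖y‖) ^ (-β)) *
        ENNReal.ofReal (‖x - y‖ ^ (-((d : ℝ) + s * p)))) := by
      refine lintegral_congr_ae ?_
      filter_upwards [ae_restrict_of_ae (ae_ne_zero hd)] with x hx
      rw [symKernel_eq_right s p α β hx hy]
      ring
    _ = F y * ENNReal.ofReal (‖y‖ ^ (-(α + β))) * (ENNReal.ofReal (‖y‖ ^ (-(s * p))) *
        ∫⁻ r in Ioo (0 : ℝ) 1, g r * ENNReal.ofReal (r ^ (-α) + r ^ (-β)) *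
          (ENNReal.ofReal (r ^ ((d : ℝ) - 1)) * Phi d s p r)) := by
      rw [← h, lintegral_const_mul _ (by fun_prop)]
    _ = _ := by
      rw [radialIntegral, ← mul_assoc, mul_assoc (F y), ← ENNReal.ofReal_mul (by positivity),
        ← Real.rpow_add hy']
      congr 1
      · congr 3
        ring
      refine setLIntegral_congr_fun measurableSet_Ioo fun r hr ↦ ?_
      have hr0 := hr.1
      -- Both separations are to use the same radial measure; the discrepancy is exactly
      -- `r^{d-α-β-sp}`, with the `α` and `β` terms exchanged.
      have e1 : (r ^ (-α) + r ^ (-β)) * r ^ ((d : ℝ) - 1) =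
          r ^ ((d : ℝ) - α - β - s * p) * (r ^ (s * p - 1) * (r ^ α + r ^ β)) := by
        simp only [mul_add, add_mul, ← Real.rpow_add hr0]
        rw [add_comm]
        congr 2 <;> ring
      have e2 := congrArg ENNReal.ofReal e1
      rw [ENNReal.ofReal_mul (by positivity), ENNReal.ofReal_mul (by positivity)] at e2
      rw [mul_assoc, ← mul_assoc (ENNReal.ofReal (r ^ (-α) + r ^ (-β))), e2]
      ring

/-- The omitted sphere `|y| = |x|` is a null set. -/
theorem lintegral_eq_norm_lt_add_lt_norm {d : ℕ} (hd : 1 ≤ d) (x : EuclideanSpace ℝ (Fin d))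
    (f : EuclideanSpace ℝ (Fin d) → ℝ≥0∞) :
    ∫⁻ y, f y = (∫⁻ y in {y | ‖x‖ < ‖y‖}, f y) + ∫⁻ y in {y | ‖y‖ < ‖x‖}, f y := by
  have : Nonempty (Fin d) := ⟨⟨0, hd⟩⟩
  rw [← lintegral_add_compl _ (measurableSet_norm_lt d x)]
  congr 1
  refine setLIntegral_congr ?_
  have : ∀ᵐ y : EuclideanSpace ℝ (Fin d), y ∉ Metric.sphere 0 ‖x‖ :=
    measure_eq_zero_iff_ae_notMem.1 (Measure.addHaar_sphere _ _ _)
  rw [Filter.eventuallyEq_set]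
  filter_upwards [this] with y hy
  have hne : ‖y‖ ≠ ‖x‖ := by simpa using hy
  simp only [mem_compl_iff, mem_ofPred_eq, not_lt, le_iff_lt_or_eq, or_iff_left hne]

/-- A double integral, folded onto the region `|x| < |y|`. -/
theorem lintegral_lintegral_eq_norm_lt {d : ℕ} (hd : 1 ≤ d)
    {f : EuclideanSpace ℝ (Fin d) → EuclideanSpace ℝ (Fin d) → ℝ≥0∞}
    (hf : Measurable (Function.uncurry f)) :
    ∫⁻ x, ∫⁻ y, f x y = ∫⁻ x, ∫⁻ y in {y | ‖x‖ < ‖y‖}, (f x y + f y x) := by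
  have hf' : Measurable (Function.uncurry fun x y ↦ f y x) := hf.comp measurable_swap
  rw [lintegral_congr fun x ↦ lintegral_eq_norm_lt_add_lt_norm hd x (f x),
    lintegral_add_left (measurable_setLIntegral_norm_lt hf),
    ← lintegral_norm_lt_swap (f := fun x y ↦ f y x) hf',
    ← lintegral_add_left (measurable_setLIntegral_norm_lt hf)]
  refine lintegral_congr fun x ↦ ?_
  have hfx : Measurable fun y ↦ f x y := hf.comp measurable_prodMk_left
  rw [← lintegral_add_left hfx]

/-- The energy as an integral over the region `|x| < |y|`. -/
theorem energy_eq {𝕜 : Type*} [RCLike 𝕜] {d : ℕ} (hd : 1 ≤ d) (s p α β : ℝ)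
    {u : EuclideanSpace ℝ (Fin d) → 𝕜} (hu : Continuous u) :
    energy d s p α β u = ∫⁻ x, ∫⁻ y in {y | ‖x‖ < ‖y‖},
      ENNReal.ofReal (‖u x - u y‖ ^ p) * symKernel d s p α β x y := by
  have hmeas : Measurable (Function.uncurry fun x y : EuclideanSpace ℝ (Fin d) ↦
      ENNReal.ofReal (‖u x - u y‖ ^ p / ‖x - y‖ ^ ((d : ℝ) + s * p) * ‖x‖ ^ (-α) *
        ‖y‖ ^ (-β))) := by
    have h1 : Measurable fun z : EuclideanSpace ℝ (Fin d) × EuclideanSpace ℝ (Fin d) ↦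
        ‖u z.1 - u z.2‖ :=
      ((hu.comp continuous_fst).sub (hu.comp continuous_snd)).norm.measurable
    simp only [Function.uncurry_def]
    fun_prop
  rw [energy, lintegral_lintegral_eq_norm_lt hd hmeas]
  refine lintegral_congr fun x ↦ lintegral_congr fun y ↦ ?_
  rw [symKernel, norm_sub_rev y x, norm_sub_rev (u y) (u x), ← ENNReal.ofReal_add (by positivity)
    (by positivity), ← ENNReal.ofReal_mul (by positivity), ← ENNReal.ofReal_mul (by positivity),
    Real.rpow_neg (norm_nonneg (x - y))]
  congr 1
  ring

theorem hardyIntegral_eq {𝕜 : Type*} [RCLike 𝕜] (d : ℕ) (s p α β : ℝ)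
    (u : EuclideanSpace ℝ (Fin d) → 𝕜) :
    hardyIntegral d s p α β u =
      ∫⁻ x, ENNReal.ofReal (‖u x‖ ^ p) * ENNReal.ofReal (‖x‖ ^ (-(s * p + α + β))) := by
  unfold hardyIntegral
  refine lintegral_congr fun x ↦ ?_
  rw [← ENNReal.ofReal_mul (by positivity), Real.rpow_neg (norm_nonneg _), div_eq_mul_inv]

theorem hardyConst_eq (d : ℕ) (s p α β : ℝ) :
    hardyConst d s p α β = radialIntegral d s p α β
      fun r ↦ ENNReal.ofReal (|1 - r ^ (((d : ℝ) - α - β - s * p) / p)| ^ p) := by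
  unfold hardyConst radialIntegral
  refine setLIntegral_congr_fun measurableSet_Ioo fun r hr ↦ ?_
  have := hr.1
  simp only
  rw [ENNReal.ofReal_mul (by positivity)]
  ring

/-! ### Finiteness -/

theorem setLIntegral_ball_norm_rpow_lt_top {d : ℕ} (hd : 1 ≤ d) {b : ℝ} (hb : -(d : ℝ) < b)
    (R : ℝ) : ∫⁻ x in Metric.ball (0 : EuclideanSpace ℝ (Fin d)) R,
      ENNReal.ofReal (‖x‖ ^ b) < ∞ := by
  have : Nonempty (Fin d) := ⟨⟨0, hd⟩⟩
  have hm : Measurable ((Iio R).indicator fun r : ℝ ↦ ENNReal.ofReal (r ^ b)) :=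
    (by fun_prop : Measurable fun r : ℝ ↦ ENNReal.ofReal (r ^ b)).indicator measurableSet_Iio
  have h := lintegral_fun_norm (volume : Measure (EuclideanSpace ℝ (Fin d))) hm
  have h1 : ∫⁻ x in Metric.ball (0 : EuclideanSpace ℝ (Fin d)) R, ENNReal.ofReal (‖x‖ ^ b) =
      ∫⁻ x : EuclideanSpace ℝ (Fin d),
        (Iio R).indicator (fun r : ℝ ↦ ENNReal.ofReal (r ^ b)) ‖x‖ := by
    rw [← lintegral_indicator measurableSet_ball]
    refine lintegral_congr fun x ↦ ?_
    by_cases hx : ‖x‖ < R <;> simp [hx, indicator]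
  rw [h1, h]
  refine ENNReal.mul_lt_top (measure_lt_top _ _) ?_
  have h2 : ∫⁻ r in Ioi (0 : ℝ), ENNReal.ofReal
      (r ^ (Module.finrank ℝ (EuclideanSpace ℝ (Fin d)) - 1)) *
        (Iio R).indicator (fun r : ℝ ↦ ENNReal.ofReal (r ^ b)) r =
      ∫⁻ r in Ioo (0 : ℝ) R, ENNReal.ofReal (r ^ ((d : ℝ) - 1 + b)) := by
    rw [← Iio_inter_Ioi.trans (rfl : Ioo (0 : ℝ) R = _), ← setLIntegral_indicator measurableSet_Iio]
    refine setLIntegral_congr_fun measurableSet_Ioi fun r (hr : 0 < r) ↦ ?_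
    by_cases h : r < R
    · simp only [indicator, mem_Iio, h, if_true]
      rw [← ENNReal.ofReal_mul (by positivity), Real.rpow_add hr, ← Real.rpow_natCast,
        finrank_euclideanSpace_fin, Nat.cast_sub hd, Nat.cast_one]
    · simp [h]
  rw [h2]
  rcases le_or_gt R 0 with hR | hR
  · simp [hR]
  · have := ((intervalIntegral.integrableOn_Ioo_rpow_iff hR).2
      (show -1 < (d : ℝ) - 1 + b by linarith)).2
    exact lt_of_le_of_lt (lintegral_mono fun r ↦ Real.ofReal_le_enorm _) this

/-- Read backwards through polar coordinates, this is the integral of `|x|^{a-d} (1 - |x|)^p |x -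
e|^{-(d+sp)}` over the unit ball. The origin is harmless because `a > 0`; at `e` the bound `1 - |x|
≤ |x - e|` leaves the exponent `p - d - sp > -d`, as `s < 1`. -/
theorem lintegral_rpow_mul_Phi_lt_top {d : ℕ} (hd : 1 ≤ d) {s p a : ℝ} (hs : 0 < s) (hs1 : s < 1)
    (hp : 1 ≤ p) (ha : 0 < a) :
    ∫⁻ r in Ioo (0 : ℝ) 1, ENNReal.ofReal (r ^ (a - 1) * (1 - r) ^ p) * Phi d s p r < ∞ := by
  have hsp : 0 < s * p := by positivity
  set e : EuclideanSpace ℝ (Fin d) := EuclideanSpace.single ⟨0, hd⟩ 1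
  have he : ‖e‖ = 1 := by simp [e]
  have he0 : e ≠ 0 := norm_pos_iff.1 (by simp [he])
  have h := setLIntegral_norm_lt_kernel_left hd s p he0
    (g := fun r ↦ ENNReal.ofReal (r ^ (a - d) * (1 - r) ^ p)) (by fun_prop)
  simp only [he, div_one, Real.one_rpow, ENNReal.ofReal_one, one_mul] at h
  have h1 : ∫⁻ r in Ioo (0 : ℝ) 1, ENNReal.ofReal (r ^ (a - 1) * (1 - r) ^ p) * Phi d s p r =
      ∫⁻ r in Ioo (0 : ℝ) 1, ENNReal.ofReal (r ^ (a - d) * (1 - r) ^ p) *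
        (ENNReal.ofReal (r ^ ((d : ℝ) - 1)) * Phi d s p r) := by
    refine setLIntegral_congr_fun measurableSet_Ioo fun r hr ↦ ?_
    have h0 := hr.1
    have h01 : 0 < 1 - r := by linarith [hr.2]
    rw [← mul_assoc, ← ENNReal.ofReal_mul (by positivity), mul_right_comm, ← Real.rpow_add h0]
    congr 4
    ring
  rw [h1, ← h]
  -- `C1` bounds the kernel on `|x| < 1/2`, where `|x - e| ≥ 1/2`. `C2` bounds `|x|^{a-d}` on `1/2 ≤
  -- |x| < 1`; the absolute value covers both signs of `a - d`.
  set C1 : ℝ := (1 / 2) ^ (-((d : ℝ) + s * p))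
  set C2 : ℝ := (1 / 2) ^ (-|a - d|)
  have hC1 : 0 ≤ C1 := by positivity
  have hC2 : 0 ≤ C2 := by positivity
  have hset : {x : EuclideanSpace ℝ (Fin d) | ‖x‖ < 1} = Metric.ball 0 1 := by
    ext x; simp
  rw [hset]
  have hbound : ∀ x ∈ Metric.ball (0 : EuclideanSpace ℝ (Fin d)) 1,
      ENNReal.ofReal (‖x‖ ^ (a - d) * (1 - ‖x‖) ^ p) *
        ENNReal.ofReal (‖x - e‖ ^ (-((d : ℝ) + s * p))) ≤
      ENNReal.ofReal C1 * ENNReal.ofReal (‖x‖ ^ (a - d)) +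
        ENNReal.ofReal C2 * ENNReal.ofReal (‖x - e‖ ^ (p - (d + s * p))) := by
    intro x hx
    have hx1 : ‖x‖ < 1 := by simpa using hx
    have h01 : 0 < 1 - ‖x‖ := by linarith
    have hxe : 1 - ‖x‖ ≤ ‖x - e‖ := by
      have := norm_sub_norm_le e x
      rw [he, norm_sub_rev] at this
      exact this
    have hpos : 0 < ‖x - e‖ := h01.trans_le hxe
    rw [← ENNReal.ofReal_mul (by positivity), ← ENNReal.ofReal_mul hC1,
      ← ENNReal.ofReal_mul hC2, ← ENNReal.ofReal_add (by positivity) (by positivity)]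
    refine ENNReal.ofReal_le_ofReal ?_
    rcases lt_or_ge ‖x‖ (1 / 2) with hlt | hge
    · have b1 : (1 - ‖x‖) ^ p ≤ 1 :=
        Real.rpow_le_one h01.le (by linarith [norm_nonneg x]) (by linarith)
      have b2 : ‖x - e‖ ^ (-((d : ℝ) + s * p)) ≤ C1 :=
        Real.rpow_le_rpow_of_nonpos (by norm_num) (by linarith)
          (by have : (0 : ℝ) ≤ d := Nat.cast_nonneg d
              linarith)
      calc ‖x‖ ^ (a - d) * (1 - ‖x‖) ^ p * ‖x - e‖ ^ (-((d : ℝ) + s * p))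
          ≤ ‖x‖ ^ (a - d) * 1 * C1 := by gcongr
        _ = C1 * ‖x‖ ^ (a - d) := by ring
        _ ≤ _ := le_add_of_nonneg_right (by positivity)
    · have hx0 : 0 < ‖x‖ := by linarith
      have b1 : ‖x‖ ^ (a - d) ≤ C2 := by
        calc ‖x‖ ^ (a - d) ≤ ‖x‖ ^ (-|a - d|) :=
              Real.rpow_le_rpow_of_exponent_ge hx0 hx1.le (neg_abs_le _)
          _ ≤ C2 := Real.rpow_le_rpow_of_nonpos (by norm_num) hge (by simp)
      have b2 : (1 - ‖x‖) ^ p ≤ ‖x - e‖ ^ p := Real.rpow_le_rpow h01.le hxe (by linarith)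
      calc ‖x‖ ^ (a - d) * (1 - ‖x‖) ^ p * ‖x - e‖ ^ (-((d : ℝ) + s * p))
          ≤ C2 * ‖x - e‖ ^ p * ‖x - e‖ ^ (-((d : ℝ) + s * p)) := by gcongr
        _ = C2 * ‖x - e‖ ^ (p - (d + s * p)) := by
          rw [mul_assoc, ← Real.rpow_add hpos, ← sub_eq_add_neg]
        _ ≤ _ := le_add_of_nonneg_left (by positivity)
  refine lt_of_le_of_lt (setLIntegral_mono (by fun_prop) hbound) ?_
  rw [lintegral_add_left (by fun_prop), lintegral_const_mul _ (by fun_prop),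
    lintegral_const_mul _ (by fun_prop)]
  refine ENNReal.add_lt_top.2 ⟨ENNReal.mul_lt_top ENNReal.ofReal_lt_top
    (setLIntegral_ball_norm_rpow_lt_top hd (by linarith) 1),
    ENNReal.mul_lt_top ENNReal.ofReal_lt_top ?_⟩
  have hsub : Metric.ball (0 : EuclideanSpace ℝ (Fin d)) 1 ⊆
      (fun x ↦ x - e) ⁻¹' Metric.ball 0 2 := by
    intro x hx
    have hx1 : ‖x‖ < 1 := by simpa using hx
    have := norm_sub_le x e
    simp only [mem_preimage, mem_ball_zero_iff]
    linarith
  refine lt_of_le_of_lt (lintegral_mono_set hsub) ?_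
  have hmp := measurePreserving_sub_right (volume : Measure (EuclideanSpace ℝ (Fin d))) e
  rw [hmp.setLIntegral_comp_preimage measurableSet_ball
    (f := fun x ↦ ENNReal.ofReal (‖x‖ ^ (p - (d + s * p)))) (by fun_prop)]
  exact setLIntegral_ball_norm_rpow_lt_top hd (by nlinarith) 2

/-- The function dominating all radial integrands that occur. -/
theorem radialIntegral_dominating_lt_top {d : ℕ} (hd : 1 ≤ d) {s p α β : ℝ} (hs : 0 < s)
    (hs1 : s < 1) (hp : 1 ≤ p) (hα : α ∈ Ioo (-(s * p)) (d : ℝ))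
    (hβ : β ∈ Ioo (-(s * p)) (d : ℝ)) :
    radialIntegral d s p α β (fun r ↦
      ENNReal.ofReal ((1 + r ^ ((d : ℝ) - α - β - s * p)) * (1 - r) ^ p)) < ∞ := by
  have key : ∀ a : ℝ, 0 < a → _ := fun a ↦ lintegral_rpow_mul_Phi_lt_top hd hs hs1 hp (a := a)
  have hΦ := measurable_Phi d s p
  have h : radialIntegral d s p α β (fun r ↦
      ENNReal.ofReal ((1 + r ^ ((d : ℝ) - α - β - s * p)) * (1 - r) ^ p)) =
      -- The four resulting exponents `a` are `sp + α`, `sp + β`, `d - β` and `d - α`, all positive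
      -- precisely by the ranges of `α` and `β`.
      ((∫⁻ r in Ioo (0 : ℝ) 1, ENNReal.ofReal (r ^ (s * p + α - 1) * (1 - r) ^ p) * Phi d s p r) +
      ∫⁻ r in Ioo (0 : ℝ) 1, ENNReal.ofReal (r ^ (s * p + β - 1) * (1 - r) ^ p) * Phi d s p r) +
      ((∫⁻ r in Ioo (0 : ℝ) 1, ENNReal.ofReal (r ^ (d - β - 1) * (1 - r) ^ p) * Phi d s p r) +
      ∫⁻ r in Ioo (0 : ℝ) 1, ENNReal.ofReal (r ^ (d - α - 1) * (1 - r) ^ p) * Phi d s p r) := by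
    rw [← lintegral_add_left (by fun_prop), ← lintegral_add_left (by fun_prop),
      ← lintegral_add_left (by fun_prop)]
    refine setLIntegral_congr_fun measurableSet_Ioo fun r hr ↦ ?_
    have h0 := hr.1
    have h01 : 0 < 1 - r := by linarith [hr.2]
    simp only
    rw [← mul_assoc, ← add_mul, ← add_mul, ← add_mul, ← ENNReal.ofReal_mul (by positivity),
      ← ENNReal.ofReal_add (by positivity) (by positivity),
      ← ENNReal.ofReal_add (by positivity) (by positivity),
      ← ENNReal.ofReal_add (by positivity) (by positivity)]
    congr 2
    rw [show s * p + α - 1 = (s * p - 1) + α by ring, show s * p + β - 1 = (s * p - 1) + β by ring,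
      show d - β - 1 = (d - α - β - s * p) + (s * p - 1) + α by ring,
      show d - α - 1 = (d - α - β - s * p) + (s * p - 1) + β by ring]
    simp only [Real.rpow_add h0]
    ring
  rw [h]
  exact ENNReal.add_lt_top.2 ⟨ENNReal.add_lt_top.2 ⟨key _ (by linarith [hα.1]),
    key _ (by linarith [hβ.1])⟩, ENNReal.add_lt_top.2 ⟨key _ (by linarith [hβ.2]),
    key _ (by linarith [hα.2])⟩⟩

/-! ### The pointwise inequality. -/

/-- Convexity of the power function, in the form of a weighted triangle inequality. -/
theorem rpow_le_of_le_add {p t A B D : ℝ} (hp : 1 ≤ p) (ht0 : 0 < t) (ht1 : t < 1) (hA : 0 ≤ A)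
    (hB : 0 ≤ B) (hD : 0 ≤ D) (h : A ≤ D + B) :
    A ^ p ≤ (1 - t) ^ (1 - p) * D ^ p + t ^ (1 - p) * B ^ p := by
  have h1t : 0 < 1 - t := by linarith
  have hc := (convexOn_rpow hp).2 (x := D / (1 - t)) (y := B / t) (by simp; positivity)
    (by simp; positivity) h1t.le ht0.le (by ring)
  simp only [smul_eq_mul, mul_div_cancel₀ _ h1t.ne', mul_div_cancel₀ _ ht0.ne'] at hc
  rw [Real.div_rpow hD h1t.le, Real.div_rpow hB ht0.le] at hc
  refine (Real.rpow_le_rpow hA h (by linarith)).trans (hc.trans_eq ?_)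
  rw [Real.rpow_sub h1t, Real.rpow_sub ht0, Real.rpow_one, Real.rpow_one]
  ring

/-- The weighted triangle inequality with weight `t = q`, multiplied by `(1 - q)^{p-1}`. This weight
gives equality for `B = q A`, `D = (1 - q) A`, the values attained by the virtual extremal. -/
theorem abs_rpow_mul_le_of_lt_one {p q A B D : ℝ} (hp : 1 ≤ p) (hq0 : 0 < q) (hq1 : q < 1)
    (hA : 0 ≤ A) (hB : 0 ≤ B) (hD : 0 ≤ D) (h : A ≤ D + B) :
    A ^ p * |1 - q| ^ (p - 1) ≤ D ^ p + B ^ p * (|1 - q| ^ (p - 1) * q ^ (1 - p)) := by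
  have h1 : 0 < 1 - q := by linarith
  rw [abs_of_pos h1]
  have hmul : (1 - q) ^ (1 - p) * (1 - q) ^ (p - 1) = 1 := by
    rw [← Real.rpow_add h1]; simp
  calc A ^ p * (1 - q) ^ (p - 1)
      ≤ ((1 - q) ^ (1 - p) * D ^ p + q ^ (1 - p) * B ^ p) * (1 - q) ^ (p - 1) := by
        gcongr
        exact rpow_le_of_le_add hp hq0 hq1 hA hB hD h
    _ = ((1 - q) ^ (1 - p) * (1 - q) ^ (p - 1)) * D ^ p +
        B ^ p * ((1 - q) ^ (p - 1) * q ^ (1 - p)) := by ring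
    _ = _ := by rw [hmul, one_mul]

/-- The previous case applied to `q⁻¹` with `A` and `B` exchanged. -/
theorem abs_rpow_mul_le_of_one_lt {p q A B D : ℝ} (hp : 1 ≤ p) (hq1 : 1 < q)
    (hA : 0 ≤ A) (hB : 0 ≤ B) (hD : 0 ≤ D) (h : B ≤ D + A) :
    B ^ p * (|1 - q| ^ (p - 1) * q ^ (1 - p)) ≤ D ^ p + A ^ p * |1 - q| ^ (p - 1) := by
  have hq0 : 0 < q := by linarith
  have h' := abs_rpow_mul_le_of_lt_one hp (inv_pos.2 hq0) (inv_lt_one_of_one_lt₀ hq1) hB hA hD h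
  have e1 : |1 - q⁻¹| = |1 - q| * q⁻¹ := by
    rw [← abs_of_pos (inv_pos.2 hq0), ← abs_mul, abs_of_pos (inv_pos.2 hq0), ← abs_neg]
    congr 1
    field_simp
    ring
  have e2 : q⁻¹ ^ (p - 1) = q ^ (1 - p) := by
    rw [Real.inv_rpow hq0.le, ← Real.rpow_neg hq0.le, neg_sub]
  have e3 : q ^ (1 - p) * q⁻¹ ^ (1 - p) = 1 := by
    rw [Real.inv_rpow hq0.le, mul_inv_cancel₀ (Real.rpow_pos_of_pos hq0 _).ne']
  rw [e1, Real.mul_rpow (abs_nonneg _) (inv_pos.2 hq0).le, e2, mul_assoc (|1 - q| ^ (p - 1)), e3,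
    mul_one] at h'
  exact h'

/-! ### The Hardy inequality. -/

theorem measurable_radialIntegrand {d : ℕ} {s p α β : ℝ} {g : ℝ → ℝ≥0∞} (hg : Measurable g) :
    Measurable fun r ↦
      g r * (ENNReal.ofReal (r ^ (s * p - 1) * (r ^ α + r ^ β)) * Phi d s p r) := by
  have hΦ := measurable_Phi d s p
  fun_prop

theorem radialIntegral_mono {d : ℕ} {s p α β : ℝ} {f g : ℝ → ℝ≥0∞}
    (h : ∀ r ∈ Ioo (0 : ℝ) 1, f r ≤ g r) :
    radialIntegral d s p α β f ≤ radialIntegral d s p α β g :=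
  setLIntegral_mono' measurableSet_Ioo fun r hr ↦ by gcongr; exact h r hr

theorem radialIntegral_congr {d : ℕ} {s p α β : ℝ} {f g : ℝ → ℝ≥0∞}
    (h : ∀ r ∈ Ioo (0 : ℝ) 1, f r = g r) :
    radialIntegral d s p α β f = radialIntegral d s p α β g :=
  setLIntegral_congr_fun measurableSet_Ioo fun r hr ↦ by simp only [h r hr]

theorem radialIntegral_add {d : ℕ} {s p α β : ℝ} {f g : ℝ → ℝ≥0∞} (hf : Measurable f) :
    radialIntegral d s p α β (fun r ↦ f r + g r) =
      radialIntegral d s p α β f + radialIntegral d s p α β g := by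
  unfold radialIntegral
  rw [← lintegral_add_left (measurable_radialIntegrand hf)]
  simp_rw [add_mul]

theorem radialIntegral_const_mul {d : ℕ} {s p α β : ℝ} {f : ℝ → ℝ≥0∞} {c : ℝ≥0∞} (hc : c ≠ ∞) :
    radialIntegral d s p α β (fun r ↦ c * f r) = c * radialIntegral d s p α β f := by
  unfold radialIntegral
  rw [← lintegral_const_mul' _ _ hc]
  simp_rw [mul_assoc]

theorem radialIntegral_iSup {d : ℕ} {s p α β : ℝ} {f : ℕ → ℝ → ℝ≥0∞} (hf : ∀ n, Measurable (f n))
    (hmono : Monotone f) :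
    radialIntegral d s p α β (fun r ↦ ⨆ n, f n r) = ⨆ n, radialIntegral d s p α β (f n) := by
  unfold radialIntegral
  rw [← lintegral_iSup (fun n ↦ measurable_radialIntegrand (hf n))]
  · simp_rw [ENNReal.iSup_mul]
  · intro m n hmn r
    have := hmono hmn r
    simp only
    gcongr

/-- Integration of a pointwise inequality over the region `|x| < |y|`. -/
theorem lintegral_norm_lt_le_add {d : ℕ} (hd : 1 ≤ d)
    {a b c : EuclideanSpace ℝ (Fin d) → EuclideanSpace ℝ (Fin d) → ℝ≥0∞}
    (hc : Measurable (Function.uncurry c))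
    (h : ∀ x y, x ≠ 0 → ‖x‖ < ‖y‖ → a x y ≤ b x y + c x y) :
    ∫⁻ x, ∫⁻ y in {y | ‖x‖ < ‖y‖}, a x y ≤
      (∫⁻ x, ∫⁻ y in {y | ‖x‖ < ‖y‖}, b x y) + ∫⁻ x, ∫⁻ y in {y | ‖x‖ < ‖y‖}, c x y := by
  rw [← lintegral_add_right _ (measurable_setLIntegral_norm_lt hc)]
  refine lintegral_mono_ae ?_
  filter_upwards [ae_ne_zero hd] with x hx
  have hcx : Measurable (c x) := hc.comp measurable_prodMk_left
  rw [← lintegral_add_right _ hcx]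
  exact setLIntegral_mono' (measurableSet_norm_lt d x) fun y hy ↦ h x y hx hy

theorem div_mem_Ioo_of_lt {a b : ℝ} (ha : 0 < a) (hab : a < b) : a / b ∈ Ioo (0 : ℝ) 1 :=
  ⟨by have := ha.trans hab; positivity, (div_lt_one (ha.trans hab)).2 hab⟩

theorem rpow_lt_one_or {γ r : ℝ} (hr : r ∈ Ioo (0 : ℝ) 1) :
    (0 < γ → r ^ γ < 1) ∧ (γ < 0 → 1 < r ^ γ) :=
  ⟨Real.rpow_lt_one hr.1.le hr.2, Real.one_lt_rpow_of_pos_of_lt_one_of_neg hr.1 hr.2⟩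

/-- The Hardy inequality with the radial integral restricted to `|1 - r^γ| > δ`. -/
theorem truncated_hardy {𝕜 : Type*} [RCLike 𝕜] {d : ℕ} (hd : 1 ≤ d) {s p α β γ : ℝ}
    (hp : 1 ≤ p) (hγ : γ * p = (d : ℝ) - α - β - s * p) (hγ0 : γ ≠ 0)
    {u : EuclideanSpace ℝ (Fin d) → 𝕜} (hu : Continuous u)
    (hH : hardyIntegral d s p α β u < ∞)
    (hC : radialIntegral d s p α β (fun r ↦ ENNReal.ofReal (|1 - r ^ γ| ^ p)) < ∞)
    {δ : ℝ} (hδ : 0 < δ) :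
    hardyIntegral d s p α β u * radialIntegral d s p α β
      ({r | δ < |1 - r ^ γ|}.indicator fun r ↦ ENNReal.ofReal (|1 - r ^ γ| ^ p)) ≤
    energy d s p α β u := by
  set S : Set ℝ := {r | δ < |1 - r ^ γ|} with hS
  have hSm : MeasurableSet S := measurableSet_lt measurable_const (by fun_prop)
  set gA : ℝ → ℝ≥0∞ := S.indicator fun r ↦ ENNReal.ofReal (|1 - r ^ γ| ^ (p - 1)) with hgA
  set gB : ℝ → ℝ≥0∞ := S.indicator fun r ↦
    ENNReal.ofReal (|1 - r ^ γ| ^ (p - 1) * (r ^ γ) ^ (1 - p)) with hgB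
  set gQ : ℝ → ℝ≥0∞ := S.indicator fun r ↦ ENNReal.ofReal (|1 - r ^ γ| ^ (p - 1) * r ^ γ) with hgQ
  set gZ : ℝ → ℝ≥0∞ := S.indicator fun r ↦ ENNReal.ofReal (|1 - r ^ γ| ^ p) with hgZ
  have mA : Measurable gA := Measurable.indicator (by fun_prop) hSm
  have mB : Measurable gB := Measurable.indicator (by fun_prop) hSm
  have mZ : Measurable gZ := Measurable.indicator (by fun_prop) hSm
  have mF : Measurable fun x ↦ ENNReal.ofReal (‖u x‖ ^ p) := by
    have := hu.measurable
    fun_prop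
  have mK := measurable_symKernel d s p α β
  have IA := lintegral_symKernel_left hd s p α β mF mA
  have IB := lintegral_symKernel_right hd s p α β mF mB
  -- The extra factor is `r^{γp} = q^p`, and `q^{1-p} q^p = q`.
  have hBQ : radialIntegral d s p α β
      (fun r ↦ gB r * ENNReal.ofReal (r ^ ((d : ℝ) - α - β - s * p))) =
      radialIntegral d s p α β gQ := by
    refine radialIntegral_congr fun r hr ↦ ?_
    simp only [hgB, hgQ, indicator]
    split_ifs
    · have hq := Real.rpow_pos_of_pos hr.1 γ
      rw [← hγ, Real.rpow_mul hr.1.le, ← ENNReal.ofReal_mul (by positivity), mul_assoc,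
        ← Real.rpow_add hq, sub_add_cancel, Real.rpow_one]
    · simp
  rw [← hardyIntegral_eq] at IA IB
  rw [hBQ] at IB
  have hsplit : ∀ z : ℝ, z ∈ S → |1 - z ^ γ| ^ p = |1 - z ^ γ| ^ (p - 1) * |1 - z ^ γ| := by
    intro z hz
    have hpos : 0 < |1 - z ^ γ| := hδ.trans hz
    nth_rewrite 3 [← Real.rpow_one |1 - z ^ γ|]
    rw [← Real.rpow_add hpos, sub_add_cancel]
  -- This is what the truncation buys: on `S`, `|1 - q|^{p-1} ≤ δ⁻¹ |1 - q|^p`, so the term to be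
  -- cancelled in `[0, ∞]` is finite.
  have hfin : ∀ (f : ℝ → ℝ) , (∀ r ∈ Ioo (0 : ℝ) 1, f r ≤ |1 - r ^ γ| ^ (p - 1)) →
      radialIntegral d s p α β (S.indicator fun r ↦ ENNReal.ofReal (f r)) < ∞ := by
    intro f hf
    refine lt_of_le_of_lt (radialIntegral_mono (g := fun r ↦
      ENNReal.ofReal δ⁻¹ * ENNReal.ofReal (|1 - r ^ γ| ^ p)) fun r hr ↦ ?_) ?_
    · by_cases hrS : r ∈ S
      · rw [indicator_of_mem hrS, ← ENNReal.ofReal_mul (by positivity)]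
        refine ENNReal.ofReal_le_ofReal ((hf r hr).trans ?_)
        rw [hsplit r hrS, ← div_eq_inv_mul, le_div_iff₀ hδ]
        gcongr
        exact le_of_lt hrS
      · rw [indicator_of_notMem hrS]
        exact zero_le
    · rw [radialIntegral_const_mul ENNReal.ofReal_ne_top]
      exact ENNReal.mul_lt_top ENNReal.ofReal_lt_top hC
  rw [energy_eq hd s p α β hu]
  -- The sign of `γ` decides whether `q > 1` or `q < 1` throughout, hence which half of the bracket
  -- is the larger one; the difference of the halves is `|1 - q|^p` in both cases.
  rcases lt_or_gt_of_ne hγ0 with hneg | hpos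
  · have hadd : radialIntegral d s p α β gQ =
        radialIntegral d s p α β gZ + radialIntegral d s p α β gA := by
      rw [← radialIntegral_add mZ]
      refine radialIntegral_congr fun r hr ↦ ?_
      by_cases hrS : r ∈ S
      · have h1 := (rpow_lt_one_or hr).2 hneg
        have hq := Real.rpow_pos_of_pos hr.1 γ
        simp only [hgQ, hgZ, hgA, indicator_of_mem hrS]
        rw [← ENNReal.ofReal_add (by positivity) (by positivity), hsplit r hrS]
        congr 1
        have : |1 - r ^ γ| = r ^ γ - 1 := by rw [abs_of_neg (by linarith)]; ring
        nth_rewrite 3 [this]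
        ring
      · simp [hgQ, hgZ, hgA, hrS]
    have hle := lintegral_norm_lt_le_add hd
      (a := fun x y ↦ ENNReal.ofReal (‖u y‖ ^ p) * gB (‖x‖ / ‖y‖) * symKernel d s p α β x y)
      (b := fun x y ↦ ENNReal.ofReal (‖u x - u y‖ ^ p) * symKernel d s p α β x y)
      (c := fun x y ↦ ENNReal.ofReal (‖u x‖ ^ p) * gA (‖x‖ / ‖y‖) * symKernel d s p α β x y)
      (by
        refine Measurable.mul ?_ mK
        fun_prop) (by
        intro x y hx hxy
        have hr := div_mem_Ioo_of_lt (norm_pos_iff.2 hx) hxy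
        rw [← add_mul]
        refine mul_le_mul_left ?_ _
        by_cases hrS : ‖x‖ / ‖y‖ ∈ S
        · simp only [hgB, hgA, indicator_of_mem hrS]
          rw [← ENNReal.ofReal_mul (by positivity), ← ENNReal.ofReal_mul (by positivity),
            ← ENNReal.ofReal_add (by positivity) (by positivity)]
          refine ENNReal.ofReal_le_ofReal (abs_rpow_mul_le_of_one_lt hp
            ((rpow_lt_one_or hr).2 hneg) (norm_nonneg _) (norm_nonneg _) (norm_nonneg _) ?_)
          rw [norm_sub_rev]
          linarith [norm_sub_norm_le (u y) (u x)]
        · simp [hgB, hrS])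
    rw [IA, IB, hadd, mul_add] at hle
    exact (ENNReal.add_le_add_iff_right (ENNReal.mul_lt_top hH (hfin _ fun _ _ ↦ le_rfl)).ne).1 hle
  · have hadd : radialIntegral d s p α β gA =
        radialIntegral d s p α β gZ + radialIntegral d s p α β gQ := by
      rw [← radialIntegral_add mZ]
      refine radialIntegral_congr fun r hr ↦ ?_
      by_cases hrS : r ∈ S
      · have h1 := (rpow_lt_one_or hr).1 hpos
        have hq := Real.rpow_pos_of_pos hr.1 γ
        simp only [hgQ, hgZ, hgA, indicator_of_mem hrS]
        rw [← ENNReal.ofReal_add (by positivity) (by positivity), hsplit r hrS]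
        congr 1
        have : |1 - r ^ γ| = 1 - r ^ γ := by rw [abs_of_pos (by linarith)]
        nth_rewrite 3 [this]
        ring
      · simp [hgQ, hgZ, hgA, hrS]
    have hle := lintegral_norm_lt_le_add hd
      (a := fun x y ↦ ENNReal.ofReal (‖u x‖ ^ p) * gA (‖x‖ / ‖y‖) * symKernel d s p α β x y)
      (b := fun x y ↦ ENNReal.ofReal (‖u x - u y‖ ^ p) * symKernel d s p α β x y)
      (c := fun x y ↦ ENNReal.ofReal (‖u y‖ ^ p) * gB (‖x‖ / ‖y‖) * symKernel d s p α β x y)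
      (by
        refine Measurable.mul ?_ mK
        fun_prop) (by
        intro x y hx hxy
        have hr := div_mem_Ioo_of_lt (norm_pos_iff.2 hx) hxy
        rw [← add_mul]
        refine mul_le_mul_left ?_ _
        by_cases hrS : ‖x‖ / ‖y‖ ∈ S
        · have hq := Real.rpow_pos_of_pos hr.1 γ
          simp only [hgB, hgA, indicator_of_mem hrS]
          rw [← ENNReal.ofReal_mul (by positivity), ← ENNReal.ofReal_mul (by positivity),
            ← ENNReal.ofReal_add (by positivity) (by positivity)]
          refine ENNReal.ofReal_le_ofReal (abs_rpow_mul_le_of_lt_one hp hq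
            ((rpow_lt_one_or hr).1 hpos) (norm_nonneg _) (norm_nonneg _) (norm_nonneg _) ?_)
          linarith [norm_sub_norm_le (u x) (u y)]
        · simp [hgA, hrS])
    rw [IA, IB, hadd, mul_add] at hle
    refine (ENNReal.add_le_add_iff_right (ENNReal.mul_lt_top hH (hfin _ fun r hr ↦ ?_)).ne).1 hle
    exact mul_le_of_le_one_right (by positivity) ((rpow_lt_one_or hr).1 hpos).le

/-- Monotone convergence in `truncated_hardy` with `δ = 1 / (n + 1)`. Since `γ ≠ 0`, `|1 - r^γ|` is
positive on all of `(0, 1)`, so the truncations exhaust the interval. -/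
theorem hardyConst_mul_hardyIntegral_le_energy {𝕜 : Type*} [RCLike 𝕜] {d : ℕ} (hd : 1 ≤ d)
    {s p α β : ℝ} (hp : 1 ≤ p) (hne : s * p + α + β ≠ d)
    {u : EuclideanSpace ℝ (Fin d) → 𝕜} (hu : Continuous u)
    (hH : hardyIntegral d s p α β u < ∞) (hC : hardyConst d s p α β < ∞) :
    hardyConst d s p α β * hardyIntegral d s p α β u ≤ energy d s p α β u := by
  set γ := ((d : ℝ) - α - β - s * p) / p with hγdef
  have hp0 : p ≠ 0 := by linarith
  have hγ : γ * p = (d : ℝ) - α - β - s * p := div_mul_cancel₀ _ hp0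
  have hγ0 : γ ≠ 0 := by
    intro h
    rw [h, zero_mul] at hγ
    exact hne (by linarith)
  rw [hardyConst_eq, ← hγdef] at hC ⊢
  set f : ℕ → ℝ → ℝ≥0∞ := fun n ↦ {r : ℝ | 1 / ((n : ℝ) + 1) < |1 - r ^ γ|}.indicator
    fun r ↦ ENNReal.ofReal (|1 - r ^ γ| ^ p) with hf
  have hmono : Monotone f := by
    intro m n hmn r
    have hsub : {r : ℝ | 1 / ((m : ℝ) + 1) < |1 - r ^ γ|} ⊆
        {r : ℝ | 1 / ((n : ℝ) + 1) < |1 - r ^ γ|} := fun r hr ↦ by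
      rw [mem_ofPred_eq] at hr ⊢
      exact (Nat.one_div_le_one_div hmn).trans_lt hr
    exact indicator_le_indicator_of_subset hsub (fun _ ↦ zero_le) r
  have hfm : ∀ n, Measurable (f n) := fun n ↦
    Measurable.indicator (by fun_prop) (measurableSet_lt measurable_const (by fun_prop))
  have hsup : radialIntegral d s p α β (fun r ↦ ENNReal.ofReal (|1 - r ^ γ| ^ p)) =
      ⨆ n, radialIntegral d s p α β (f n) := by
    rw [← radialIntegral_iSup hfm hmono]
    refine radialIntegral_congr fun r hr ↦ le_antisymm ?_ (iSup_le fun n ↦ indicator_le_self _ _ _)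
    have hpos : 0 < |1 - r ^ γ| := by
      refine abs_pos.2 (sub_ne_zero.2 ?_)
      rcases lt_or_gt_of_ne hγ0 with h | h
      · exact ((rpow_lt_one_or hr).2 h).ne
      · exact ((rpow_lt_one_or hr).1 h).ne'
    obtain ⟨n, hn⟩ := exists_nat_one_div_lt hpos
    refine le_trans (le_of_eq ?_) (le_iSup (fun n ↦ f n r) n)
    simp only [hf]
    rw [indicator_of_mem]
    exact hn
  rw [hsup, ENNReal.iSup_mul]
  refine iSup_le fun n ↦ ?_
  rw [mul_comm]
  exact truncated_hardy hd hp hγ hγ0 hu hH hC (by positivity)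

/-! ### Finiteness of the constant and of the Hardy integrals. -/

/-- For `γ ≤ 1` because `r ≤ r^γ`; for `γ ≥ 1` this is Bernoulli's inequality. -/
theorem one_sub_rpow_le {γ r : ℝ} (hr : r ∈ Ioo (0 : ℝ) 1) :
    1 - r ^ γ ≤ max 1 γ * (1 - r) := by
  have h1 : 0 < 1 - r := by linarith [hr.2]
  rcases le_total γ 1 with h | h
  · have := Real.rpow_le_rpow_of_exponent_ge hr.1 hr.2.le h
    rw [Real.rpow_one] at this
    rw [max_eq_left h]
    linarith
  · have := one_add_mul_self_le_rpow_one_add (s := r - 1) (by linarith [hr.1]) h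
    rw [max_eq_right h]
    rw [add_sub_cancel] at this
    linarith

/-- Linear vanishing at `r = 1` supplies `(1 - r)^p`. For `γ < 0` one writes `r^γ - 1 = r^γ (1 -
r^{-γ})`, which accounts for the summand `r^{γp}`. -/
theorem abs_one_sub_rpow_rpow_le {γ p r : ℝ} (hp : 0 ≤ p) (hr : r ∈ Ioo (0 : ℝ) 1) :
    |1 - r ^ γ| ^ p ≤ max 1 |γ| ^ p * ((1 + r ^ (γ * p)) * (1 - r) ^ p) := by
  have h1 : 0 < 1 - r := by linarith [hr.2]
  have hr0 := hr.1
  have hM : 0 ≤ max 1 |γ| := by positivity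
  rcases le_or_gt 0 γ with h | h
  · have hq : r ^ γ ≤ 1 := Real.rpow_le_one hr.1.le hr.2.le h
    have hb : |1 - r ^ γ| ≤ max 1 |γ| * (1 - r) := by
      rw [abs_of_nonneg (by linarith), abs_of_nonneg h]
      exact one_sub_rpow_le hr
    calc |1 - r ^ γ| ^ p ≤ (max 1 |γ| * (1 - r)) ^ p := by gcongr
      _ = max 1 |γ| ^ p * (1 * (1 - r) ^ p) := by rw [Real.mul_rpow hM h1.le, one_mul]
      _ ≤ _ := by
        gcongr
        linarith [Real.rpow_pos_of_pos hr0 (γ * p)]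
  · have hq : 1 < r ^ γ := (rpow_lt_one_or hr).2 h
    have hb : |1 - r ^ γ| ≤ r ^ γ * (max 1 |γ| * (1 - r)) := by
      have h2 := one_sub_rpow_le (γ := -γ) hr
      rw [abs_of_neg (by linarith), abs_of_neg h]
      calc -(1 - r ^ γ) = r ^ γ * (1 - r ^ (-γ)) := by
            rw [mul_sub, ← Real.rpow_add hr0, add_neg_cancel, Real.rpow_zero]; ring
        _ ≤ _ := by gcongr
    calc |1 - r ^ γ| ^ p ≤ (r ^ γ * (max 1 |γ| * (1 - r))) ^ p := by gcongr
      _ = max 1 |γ| ^ p * (r ^ (γ * p) * (1 - r) ^ p) := by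
        rw [Real.mul_rpow (by positivity) (by positivity), Real.mul_rpow hM h1.le,
          Real.rpow_mul hr0.le]
        ring
      _ ≤ _ := by
        gcongr
        linarith

theorem hardyConst_lt_top {d : ℕ} (hd : 1 ≤ d) {s p α β : ℝ} (hs : 0 < s)
    (hs1 : s < 1) (hp : 1 ≤ p) (hα : α ∈ Ioo (-(s * p)) (d : ℝ))
    (hβ : β ∈ Ioo (-(s * p)) (d : ℝ)) : hardyConst d s p α β < ∞ := by
  set γ := ((d : ℝ) - α - β - s * p) / p with hγdef
  have hγ : γ * p = (d : ℝ) - α - β - s * p := div_mul_cancel₀ _ (by linarith)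
  rw [hardyConst_eq, ← hγdef]
  refine lt_of_le_of_lt (radialIntegral_mono (g := fun r ↦ ENNReal.ofReal (max 1 |γ| ^ p) *
    ENNReal.ofReal ((1 + r ^ ((d : ℝ) - α - β - s * p)) * (1 - r) ^ p)) fun r hr ↦ ?_) ?_
  · rw [← ENNReal.ofReal_mul (by positivity), ← hγ]
    exact ENNReal.ofReal_le_ofReal (abs_one_sub_rpow_rpow_le (by linarith) hr)
  · rw [radialIntegral_const_mul ENNReal.ofReal_ne_top]
    exact ENNReal.mul_lt_top ENNReal.ofReal_lt_top
      (radialIntegral_dominating_lt_top hd hs hs1 hp hα hβ)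

theorem hardyIntegral_lt_top_of_lt {𝕜 : Type*} [RCLike 𝕜] {d : ℕ} (hd : 1 ≤ d)
    {s p α β : ℝ} (hp : 1 ≤ p) (hlt : s * p + α + β < d)
    {u : EuclideanSpace ℝ (Fin d) → 𝕜} (hu : Continuous u) (hc : HasCompactSupport u) :
    hardyIntegral d s p α β u < ∞ := by
  obtain ⟨M, hM⟩ := hc.exists_bound_of_continuous hu
  obtain ⟨R, hR⟩ := hc.isCompact.isBounded.subset_ball 0
  have hfin := setLIntegral_ball_norm_rpow_lt_top hd (b := -(s * p + α + β)) (by linarith) R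
  rw [hardyIntegral_eq]
  refine lt_of_le_of_lt (lintegral_mono (g := (Metric.ball 0 R).indicator fun x ↦
    ENNReal.ofReal (M ^ p) * ENNReal.ofReal (‖x‖ ^ (-(s * p + α + β)))) fun x ↦ ?_) ?_
  · by_cases hx : x ∈ Metric.ball 0 R
    · rw [indicator_of_mem hx]
      have := hM x
      dsimp only
      gcongr
    · have : u x = 0 := image_eq_zero_of_notMem_tsupport fun h ↦ hx (hR h)
      simp [this, Real.zero_rpow (by linarith : p ≠ 0)]
  · rw [lintegral_indicator measurableSet_ball, lintegral_const_mul _ (by fun_prop)]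
    exact ENNReal.mul_lt_top ENNReal.ofReal_lt_top hfin

theorem hardyIntegral_lt_top_of_zero_notMem {𝕜 : Type*} [RCLike 𝕜] {d : ℕ}
    {s p α β : ℝ} (hp : 1 ≤ p)
    {u : EuclideanSpace ℝ (Fin d) → 𝕜} (hu : Continuous u) (hc : HasCompactSupport u)
    (h0 : (0 : EuclideanSpace ℝ (Fin d)) ∉ tsupport u) :
    hardyIntegral d s p α β u < ∞ := by
  obtain ⟨M, hM⟩ := hc.isCompact.exists_bound_of_continuousOn
    (f := fun x ↦ ‖u x‖ ^ p * ‖x‖ ^ (-(s * p + α + β))) (by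
      refine ContinuousOn.mul (hu.norm.continuousOn.rpow_const fun x _ ↦ Or.inr (by linarith))
        (continuous_norm.continuousOn.rpow_const fun x hx ↦ Or.inl ?_)
      exact norm_ne_zero_iff.2 fun h ↦ h0 (h ▸ hx))
  rw [hardyIntegral_eq]
  refine lt_of_le_of_lt (lintegral_mono (g := (tsupport u).indicator fun _ ↦
    ENNReal.ofReal M) fun x ↦ ?_) ?_
  · by_cases hx : x ∈ tsupport u
    · rw [indicator_of_mem hx, ← ENNReal.ofReal_mul (by positivity)]
      exact ENNReal.ofReal_le_ofReal ((le_abs_self _).trans (hM x hx))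
    · have : u x = 0 := image_eq_zero_of_notMem_tsupport hx
      simp [this, Real.zero_rpow (by linarith : p ≠ 0)]
  · rw [lintegral_indicator_const (isClosed_tsupport u).measurableSet]
    exact ENNReal.mul_lt_top ENNReal.ofReal_lt_top hc.isCompact.measure_lt_top

/-! ### Test functions -/

/-- The tent function of height one in the variable `log ρ`, supported in `[-L, L]`. -/
noncomputable def logTent (L ρ : ℝ) : ℝ := max 0 (1 - |Real.log ρ| / L)

/-- The annulus `e^{-L} ≤ |x| ≤ e^L`. -/
def annulus (d : ℕ) (L : ℝ) : Set (EuclideanSpace ℝ (Fin d)) :=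
  {x | ‖x‖ ∈ Icc (Real.exp (-L)) (Real.exp L)}

theorem isClosed_annulus (d : ℕ) (L : ℝ) : IsClosed (annulus d L) :=
  isClosed_Icc.preimage continuous_norm

theorem isCompact_annulus (d : ℕ) (L : ℝ) : IsCompact (annulus d L) := by
  refine (isCompact_closedBall (0 : EuclideanSpace ℝ (Fin d)) (Real.exp L)).of_isClosed_subset
    (isClosed_annulus d L) fun x hx ↦ ?_
  simpa using hx.2

theorem zero_notMem_annulus (d : ℕ) (L : ℝ) : (0 : EuclideanSpace ℝ (Fin d)) ∉ annulus d L := by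
  intro h
  have := h.1
  rw [norm_zero] at this
  exact absurd this (not_le.2 (Real.exp_pos _))

theorem mem_annulus_iff {d : ℕ} {L : ℝ} {x : EuclideanSpace ℝ (Fin d)} (hx : x ≠ 0) :
    x ∈ annulus d L ↔ |Real.log ‖x‖| ≤ L := by
  have h := norm_pos_iff.2 hx
  rw [abs_le, Real.le_log_iff_exp_le h, Real.log_le_iff_le_exp h]
  rfl

theorem logTent_nonneg (L ρ : ℝ) : 0 ≤ logTent L ρ := le_max_left _ _

theorem logTent_le_one {L : ℝ} (hL : 0 < L) (ρ : ℝ) : logTent L ρ ≤ 1 :=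
  max_le zero_le_one (by linarith [show 0 ≤ |Real.log ρ| / L by positivity])

theorem logTent_eq_zero {d : ℕ} {L : ℝ} (hL : 0 < L) {x : EuclideanSpace ℝ (Fin d)} (hx : x ≠ 0)
    (h : x ∉ annulus d L) : logTent L ‖x‖ = 0 := by
  rw [mem_annulus_iff hx, not_le] at h
  refine max_eq_left ?_
  have := (one_lt_div hL).2 h
  linarith

/-- The tent takes values in `[0, 1]` and is `1/L`-Lipschitz in `log ρ`. -/
theorem abs_logTent_sub_le {L a b : ℝ} (hL : 0 < L) (ha : 0 < a) (hab : a < b) :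
    |logTent L a - logTent L b| ≤ min 1 (-Real.log (a / b) / L) := by
  refine le_min ?_ ?_
  · rw [abs_le]
    constructor <;> linarith [logTent_nonneg L a, logTent_nonneg L b, logTent_le_one hL a,
      logTent_le_one hL b]
  · calc |logTent L a - logTent L b|
        ≤ max |(0 : ℝ) - 0| |(1 - |Real.log a| / L) - (1 - |Real.log b| / L)| :=
          abs_max_sub_max_le_max _ _ _ _
      _ = |(|Real.log b| - |Real.log a|)| / L := by
          have e : (1 - |Real.log a| / L) - (1 - |Real.log b| / L) =
              (|Real.log b| - |Real.log a|) / L := by ring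
          rw [sub_zero, abs_zero, max_eq_right (abs_nonneg _), e, abs_div, abs_of_pos hL]
      _ ≤ |Real.log b - Real.log a| / L :=
          div_le_div_of_nonneg_right (abs_abs_sub_abs_le_abs_sub _ _) hL.le
      _ = -Real.log (a / b) / L := by
          rw [Real.log_div ha.ne' (ha.trans hab).ne', neg_sub,
            abs_of_pos (sub_pos.2 (Real.log_lt_log ha hab))]

/-- The test function `|x|^{-γ}` times a logarithmic cutoff. -/
noncomputable def testFun (𝕜 : Type*) [RCLike 𝕜] (d : ℕ) (γ L : ℝ) (x : EuclideanSpace ℝ (Fin d)) :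
    𝕜 :=
  ((‖x‖ ^ (-γ) * logTent L ‖x‖ : ℝ) : 𝕜)

section TestFun

variable {𝕜 : Type*} [RCLike 𝕜] {d : ℕ} {γ L : ℝ}

theorem testFun_eq_zero (hγ : γ ≠ 0) (hL : 0 < L) {x : EuclideanSpace ℝ (Fin d)}
    (h : x ∉ annulus d L) : testFun 𝕜 d γ L x = 0 := by
  unfold testFun
  by_cases hx : x = 0
  -- As `log 0 = 0`, the tent equals `1` at the origin; the product vanishes there thanks to the
  -- convention `0^{-γ} = 0` for `γ ≠ 0`.
  · simp [hx, Real.zero_rpow (neg_ne_zero.2 hγ)]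
  · simp [logTent_eq_zero hL hx h]

theorem continuous_testFun (hγ : γ ≠ 0) (hL : 0 < L) : Continuous (testFun 𝕜 d γ L) := by
  rw [continuous_iff_continuousAt]
  intro x
  by_cases hx : x = 0
  · have hev : testFun 𝕜 d γ L =ᶠ[nhds x] fun _ ↦ 0 := by
      filter_upwards [(isClosed_annulus d L).isOpen_compl.mem_nhds
        (hx ▸ zero_notMem_annulus d L)] with y hy
      exact testFun_eq_zero hγ hL hy
    exact continuousAt_const.congr hev.symm
  · have hn := norm_ne_zero_iff.2 hx
    unfold testFun logTent
    refine RCLike.continuous_ofReal.continuousAt.comp ?_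
    refine (continuous_norm.continuousAt.rpow_const (Or.inl hn)).mul ?_
    exact continuousAt_const.max (continuousAt_const.sub
      ((continuous_norm.continuousAt.log hn).abs.div_const L))

theorem tsupport_testFun_subset (hγ : γ ≠ 0) (hL : 0 < L) :
    tsupport (testFun 𝕜 d γ L) ⊆ annulus d L :=
  closure_minimal (fun _ hx ↦ by_contra fun h ↦ hx (testFun_eq_zero hγ hL h))
    (isClosed_annulus d L)

theorem hasCompactSupport_testFun (hγ : γ ≠ 0) (hL : 0 < L) :
    HasCompactSupport (testFun 𝕜 d γ L) :=
  (isCompact_annulus d L).of_isClosed_subset (isClosed_tsupport _) (tsupport_testFun_subset hγ hL)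

theorem norm_testFun (x : EuclideanSpace ℝ (Fin d)) :
    ‖testFun 𝕜 d γ L x‖ = ‖x‖ ^ (-γ) * logTent L ‖x‖ := by
  rw [testFun, RCLike.norm_ofReal, abs_of_nonneg]
  exact mul_nonneg (by positivity) (logTent_nonneg _ _)

end TestFun

/-- The invariant measure of an annulus. -/
theorem setLIntegral_annulus {d : ℕ} (hd : 1 ≤ d) {L : ℝ} (hL : 0 < L) :
    ∫⁻ x in annulus d L, ENNReal.ofReal (‖x‖ ^ (-(d : ℝ))) =
      sphereArea d * ENNReal.ofReal (2 * L) := by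
  have : Nonempty (Fin d) := ⟨⟨0, hd⟩⟩
  have hlt : Real.exp (-L) ≤ Real.exp L := Real.exp_le_exp.2 (by linarith)
  set I := Icc (Real.exp (-L)) (Real.exp L) with hI
  have hm : Measurable (I.indicator fun r : ℝ ↦ ENNReal.ofReal (r ^ (-(d : ℝ)))) :=
    Measurable.indicator (by fun_prop) measurableSet_Icc
  have h := lintegral_fun_norm (volume : Measure (EuclideanSpace ℝ (Fin d))) hm
  rw [← lintegral_indicator (isClosed_annulus d L).measurableSet]
  change ∫⁻ x : EuclideanSpace ℝ (Fin d),
    I.indicator (fun r : ℝ ↦ ENNReal.ofReal (r ^ (-(d : ℝ)))) ‖x‖ = _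
  rw [h, sphereArea]
  congr 1
  have hsub : I ⊆ Ioi 0 := fun r hr ↦ (Real.exp_pos _).trans_le hr.1
  calc
    _ = ∫⁻ r in I, ENNReal.ofReal r⁻¹ := by
      rw [← inter_eq_self_of_subset_left hsub, ← setLIntegral_indicator measurableSet_Icc]
      refine setLIntegral_congr_fun measurableSet_Ioi fun r (hr : 0 < r) ↦ ?_
      rw [inter_eq_self_of_subset_left hsub]
      by_cases h : r ∈ I
      · rw [indicator_of_mem h, indicator_of_mem h, ← ENNReal.ofReal_mul (by positivity),
          finrank_euclideanSpace_fin, ← Real.rpow_natCast, ← Real.rpow_add hr, Nat.cast_sub hd,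
          Nat.cast_one, ← Real.rpow_neg_one]
        congr 2
        ring
      · rw [indicator_of_notMem h, indicator_of_notMem h, mul_zero]
    _ = ENNReal.ofReal (∫ r in I, r⁻¹) := by
      rw [ofReal_integral_eq_lintegral_ofReal]
      · exact (continuousOn_inv₀.mono fun r hr ↦ (hsub hr).ne').integrableOn_Icc
      · filter_upwards [ae_restrict_mem measurableSet_Icc] with r hr
        exact inv_nonneg.2 (hsub hr).le
    _ = _ := by
      rw [integral_Icc_eq_integral_Ioc, ← intervalIntegral.integral_of_le hlt,
        integral_inv_of_pos (Real.exp_pos _) (Real.exp_pos _), ← Real.exp_sub, Real.log_exp]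
      congr 1
      ring

/-! ### Optimality of the constant. -/

section Optimality

variable {𝕜 : Type*} [RCLike 𝕜] {d : ℕ} {s p α β γ L : ℝ}

/-- The exponents `γp` and `sp + α + β` add up to `d`, so the integrand is the density of the
dilation-invariant measure. -/
theorem setLIntegral_annulus_weight (hd : 1 ≤ d) (hγ : γ * p = (d : ℝ) - α - β - s * p)
    (hL : 0 < L) :
    ∫⁻ x, (annulus d L).indicator (fun x ↦ ENNReal.ofReal (‖x‖ ^ (-(γ * p)))) x *
      ENNReal.ofReal (‖x‖ ^ (-(s * p + α + β))) = sphereArea d * ENNReal.ofReal (2 * L) := by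
  rw [← setLIntegral_annulus hd hL, ← lintegral_indicator (isClosed_annulus d L).measurableSet]
  refine lintegral_congr fun x ↦ ?_
  by_cases hx : x ∈ annulus d L
  · have hx0 : 0 < ‖x‖ := (Real.exp_pos _).trans_le hx.1
    rw [indicator_of_mem hx, indicator_of_mem hx, ← ENNReal.ofReal_mul (by positivity),
      ← Real.rpow_add hx0]
    congr 2
    linarith
  · simp [hx]

/-- On the annulus of logarithmic half-width `L / 2` the tent is at least `1/2`. -/
theorem le_hardyIntegral_testFun (hd : 1 ≤ d) (hp : 1 ≤ p)
    (hγ : γ * p = (d : ℝ) - α - β - s * p) (hL : 0 < L) :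
    ENNReal.ofReal ((1 / 2) ^ p) * (sphereArea d * ENNReal.ofReal L) ≤
      hardyIntegral d s p α β (testFun 𝕜 d γ L) := by
  have h := setLIntegral_annulus_weight hd hγ (half_pos hL)
  rw [mul_div_cancel₀ L two_ne_zero] at h
  rw [← h, ← lintegral_const_mul' _ _ ENNReal.ofReal_ne_top, hardyIntegral_eq]
  refine lintegral_mono fun x ↦ ?_
  simp only
  rw [← mul_assoc]
  refine mul_le_mul_left ?_ _
  by_cases hx : x ∈ annulus d (L / 2)
  · have hx0 : 0 < ‖x‖ := (Real.exp_pos _).trans_le hx.1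
    rw [indicator_of_mem hx, ← ENNReal.ofReal_mul (by positivity), norm_testFun]
    refine ENNReal.ofReal_le_ofReal ?_
    have hlog := (mem_annulus_iff (norm_pos_iff.1 hx0)).1 hx
    have htent : 1 / 2 ≤ logTent L ‖x‖ := by
      refine le_max_of_le_right ?_
      have : |Real.log ‖x‖| / L ≤ 1 / 2 := by
        rw [div_le_iff₀ hL]
        linarith
      linarith
    rw [Real.mul_rpow (by positivity) (by linarith), ← Real.rpow_mul hx0.le, neg_mul, mul_comm]
    gcongr
  · simp [hx]

/-- The part of the energy of a test function that is due to the cutoff. -/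
noncomputable def cutoffIntegral (d : ℕ) (s p α β L : ℝ) : ℝ≥0∞ :=
  radialIntegral d s p α β fun r ↦ ENNReal.ofReal (min 1 (-Real.log r / L) ^ p) *
    ENNReal.ofReal (r ^ ((d : ℝ) - α - β - s * p))

/-- With `T` the tent and `q = (|x| / |y|)^γ`, the difference is `u(x) (1 - q) + |y|^{-γ} (T(x) -
T(y))`. The weighted triangle inequality with small `l` keeps the coefficient of the main term close
to one. -/
theorem norm_testFun_sub_rpow_le (hp : 1 ≤ p) {l : ℝ}
    (hl0 : 0 < l) (hl1 : l < 1) {x y : EuclideanSpace ℝ (Fin d)} (hx : x ≠ 0) (hxy : ‖x‖ < ‖y‖) :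
    ‖testFun 𝕜 d γ L x - testFun 𝕜 d γ L y‖ ^ p ≤
      (1 - l) ^ (1 - p) * (‖testFun 𝕜 d γ L x‖ ^ p * |1 - (‖x‖ / ‖y‖) ^ γ| ^ p) +
      l ^ (1 - p) * (‖y‖ ^ (-(γ * p)) * |logTent L ‖x‖ - logTent L ‖y‖| ^ p) := by
  have hX := norm_pos_iff.2 hx
  have hY := hX.trans hxy
  have hT := logTent_nonneg L ‖x‖
  have hw : ‖y‖ ^ (-γ) = ‖x‖ ^ (-γ) * (‖x‖ / ‖y‖) ^ γ := by
    rw [Real.div_rpow hX.le hY.le, Real.rpow_neg hX.le, Real.rpow_neg hY.le]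
    have := (Real.rpow_pos_of_pos hX γ).ne'
    field_simp
  have hle : ‖testFun 𝕜 d γ L x - testFun 𝕜 d γ L y‖ ≤
      ‖testFun 𝕜 d γ L x‖ * |1 - (‖x‖ / ‖y‖) ^ γ| +
        ‖y‖ ^ (-γ) * |logTent L ‖x‖ - logTent L ‖y‖| := by
    rw [norm_testFun, testFun, testFun, ← RCLike.ofReal_sub, RCLike.norm_ofReal]
    have e : ‖x‖ ^ (-γ) * logTent L ‖x‖ - ‖y‖ ^ (-γ) * logTent L ‖y‖ =
        ‖x‖ ^ (-γ) * logTent L ‖x‖ * (1 - (‖x‖ / ‖y‖) ^ γ) +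
          ‖y‖ ^ (-γ) * (logTent L ‖x‖ - logTent L ‖y‖) := by
      rw [hw]
      ring
    rw [e]
    refine (abs_add_le _ _).trans_eq ?_
    rw [abs_mul, abs_mul (‖y‖ ^ (-γ)), abs_of_nonneg (mul_nonneg (by positivity) hT),
      abs_of_nonneg (by positivity : 0 ≤ ‖y‖ ^ (-γ))]
  refine (rpow_le_of_le_add hp hl0 hl1 (norm_nonneg _) (by positivity) (by positivity)
    hle).trans_eq ?_
  rw [Real.mul_rpow (norm_nonneg _) (abs_nonneg _), Real.mul_rpow (by positivity) (abs_nonneg _),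
    ← Real.rpow_mul hY.le, neg_mul]

/-- The main term reproduces the constant up to `(1 - l)^{1-p}`. The cutoff term is separated once
with its weight at `x` and once at `y`; both give the same `cutoffIntegral`, whence the factor `2`.
-/
theorem energy_testFun_le (hd : 1 ≤ d) (hp : 1 ≤ p)
    (hγ : γ * p = (d : ℝ) - α - β - s * p) (hγ0 : γ ≠ 0) (hL : 0 < L) {l : ℝ}
    (hl0 : 0 < l) (hl1 : l < 1) :
    energy d s p α β (testFun 𝕜 d γ L) ≤
      hardyIntegral d s p α β (testFun 𝕜 d γ L) *
        (ENNReal.ofReal ((1 - l) ^ (1 - p)) *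
          radialIntegral d s p α β fun r ↦ ENNReal.ofReal (|1 - r ^ γ| ^ p)) +
      sphereArea d * ENNReal.ofReal (2 * L) *
        (ENNReal.ofReal (2 * l ^ (1 - p)) * cutoffIntegral d s p α β L) := by
  have h1l : 0 < 1 - l := by linarith
  set u := testFun 𝕜 d γ L with hudef
  have hu : Continuous u := continuous_testFun hγ0 hL
  set c1 := ENNReal.ofReal ((1 - l) ^ (1 - p)) with hc1
  set c2 := ENNReal.ofReal (l ^ (1 - p)) with hc2
  set W : EuclideanSpace ℝ (Fin d) → ℝ≥0∞ :=
    (annulus d L).indicator (fun x ↦ ENNReal.ofReal (‖x‖ ^ (-(γ * p)))) with hW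
  set ψ : ℝ → ℝ≥0∞ := fun r ↦ ENNReal.ofReal (min 1 (-Real.log r / L) ^ p) with hψ
  have mK := measurable_symKernel d s p α β
  have mF : Measurable fun x ↦ ENNReal.ofReal (‖u x‖ ^ p) := by
    have := hu.measurable
    fun_prop
  have mW : Measurable W := Measurable.indicator (by fun_prop) (isClosed_annulus d L).measurableSet
  have mψ : Measurable ψ := by
    have : Measurable fun r : ℝ ↦ min 1 (-Real.log r / L) :=
      measurable_const.min (by fun_prop)
    fun_prop
  have mg : Measurable fun r : ℝ ↦ c1 * ENNReal.ofReal (|1 - r ^ γ| ^ p) := by fun_prop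
  have mψ2 : Measurable fun r : ℝ ↦ c2 * ψ r := by fun_prop
  have mψ1 : Measurable fun r : ℝ ↦
      c2 * (ψ r * ENNReal.ofReal (r ^ ((d : ℝ) - α - β - s * p))) := by fun_prop
  have I0 := lintegral_symKernel_left hd s p α β mF mg
  have I1 := lintegral_symKernel_left hd s p α β mW mψ1
  have I2 := lintegral_symKernel_right hd s p α β mW mψ2
  rw [← hardyIntegral_eq, radialIntegral_const_mul ENNReal.ofReal_ne_top] at I0
  rw [setLIntegral_annulus_weight hd hγ hL, radialIntegral_const_mul ENNReal.ofReal_ne_top] at I1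
  simp_rw [mul_assoc c2] at I2
  rw [setLIntegral_annulus_weight hd hγ hL, radialIntegral_const_mul ENNReal.ofReal_ne_top] at I2
  have m2 : Measurable (Function.uncurry fun x y : EuclideanSpace ℝ (Fin d) ↦
      W y * (c2 * ψ (‖x‖ / ‖y‖)) * symKernel d s p α β x y) := by
    refine Measurable.mul ?_ mK
    fun_prop
  have m1 : Measurable (Function.uncurry fun x y : EuclideanSpace ℝ (Fin d) ↦
      W x * (c2 * (ψ (‖x‖ / ‖y‖) * ENNReal.ofReal ((‖x‖ / ‖y‖) ^ ((d : ℝ) - α - β - s * p)))) *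
        symKernel d s p α β x y) := by
    refine Measurable.mul ?_ mK
    fun_prop
  have hle2 := lintegral_norm_lt_le_add hd m2 (fun x y _ _ ↦ le_rfl) (b := fun x y ↦
      W x * (c2 * (ψ (‖x‖ / ‖y‖) * ENNReal.ofReal ((‖x‖ / ‖y‖) ^ ((d : ℝ) - α - β - s * p)))) *
        symKernel d s p α β x y)
  rw [I1, I2] at hle2
  have hle1 := lintegral_norm_lt_le_add hd
    (a := fun x y ↦ ENNReal.ofReal (‖u x - u y‖ ^ p) * symKernel d s p α β x y)
    (b := fun x y ↦ ENNReal.ofReal (‖u x‖ ^ p) *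
      (c1 * ENNReal.ofReal (|1 - (‖x‖ / ‖y‖) ^ γ| ^ p)) * symKernel d s p α β x y)
    (c := fun x y ↦
      W x * (c2 * (ψ (‖x‖ / ‖y‖) * ENNReal.ofReal ((‖x‖ / ‖y‖) ^ ((d : ℝ) - α - β - s * p)))) *
        symKernel d s p α β x y + W y * (c2 * ψ (‖x‖ / ‖y‖)) * symKernel d s p α β x y)
    (m1.add m2) (by
      intro x y hx hxy
      have hX := norm_pos_iff.2 hx
      have hY := hX.trans hxy
      have hr := div_mem_Ioo_of_lt hX hxy
      have hlog : 0 < -Real.log (‖x‖ / ‖y‖) := by linarith [Real.log_neg hr.1 hr.2]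
      rw [← add_mul, ← add_mul]
      refine mul_le_mul_left ?_ _
      refine (ENNReal.ofReal_le_ofReal (norm_testFun_sub_rpow_le hp hl0 hl1 hx hxy)).trans ?_
      rw [ENNReal.ofReal_add (by positivity) (by positivity)]
      refine add_le_add (le_of_eq ?_) ?_
      · rw [ENNReal.ofReal_mul (by positivity), ENNReal.ofReal_mul (by positivity)]
        ring
      · rw [ENNReal.ofReal_mul (by positivity), ← hc2]
        clear_value c2
        have hT := Real.rpow_le_rpow (abs_nonneg _) (abs_logTent_sub_le hL hX hxy)
          (by linarith : 0 ≤ p)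
        -- The tents differ only if `x` or `y` lies in the annulus. In the first case `|y|^{-γp}` is
        -- rewritten as `|x|^{-γp} r^{γp}`, so that the weight sits at a point of the annulus.
        by_cases hxA : x ∈ annulus d L
        · refine le_trans ?_ le_self_add
          have e : ‖y‖ ^ (-(γ * p)) = ‖x‖ ^ (-(γ * p)) * (‖x‖ / ‖y‖) ^ (γ * p) := by
            rw [Real.div_rpow hX.le hY.le, Real.rpow_neg hX.le, Real.rpow_neg hY.le]
            have := (Real.rpow_pos_of_pos hX (γ * p)).ne'
            field_simp
          rw [hW, indicator_of_mem hxA, mul_left_comm, ← hγ, hψ,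
            ← ENNReal.ofReal_mul (by positivity), ← ENNReal.ofReal_mul (by positivity), e]
          refine mul_le_mul_right (ENNReal.ofReal_le_ofReal ?_) _
          rw [mul_assoc, mul_comm (min _ _ ^ p)]
          gcongr
        · by_cases hyA : y ∈ annulus d L
          · refine le_trans ?_ le_add_self
            simp only [hW, indicator_of_mem hyA, hψ]
            rw [mul_left_comm, ← ENNReal.ofReal_mul (by positivity)]
            refine mul_le_mul_right (ENNReal.ofReal_le_ofReal ?_) _
            gcongr
          · rw [logTent_eq_zero hL hx hxA, logTent_eq_zero hL (norm_pos_iff.1 hY) hyA]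
            simp [Real.zero_rpow (by linarith : p ≠ 0)])
  rw [I0, ← energy_eq hd s p α β hu] at hle1
  refine hle1.trans (add_le_add le_rfl (hle2.trans_eq ?_))
  have hcut : cutoffIntegral d s p α β L = radialIntegral d s p α β fun r ↦
      ψ r * ENNReal.ofReal (r ^ ((d : ℝ) - α - β - s * p)) := rfl
  rw [ENNReal.ofReal_mul (p := 2) (q := l ^ (1 - p)) zero_le_two, ENNReal.ofReal_ofNat, hcut]
  ring

/-- A bound uniform in `L ≥ 1`, needed for dominated convergence of the cutoff integrals. -/
theorem min_neg_log_le {r : ℝ} (hr : r ∈ Ioo (0 : ℝ) 1) {L : ℝ} (hL : 1 ≤ L) :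
    min 1 (-Real.log r / L) ≤ 2 * (1 - r) := by
  rcases le_total r (1 / 2) with h | h
  · exact (min_le_left _ _).trans (by linarith)
  · refine (min_le_right _ _).trans ?_
    have hlog : 0 < -Real.log r := by linarith [Real.log_neg hr.1 hr.2]
    have h1 : -Real.log r ≤ r⁻¹ - 1 := by
      rw [← Real.log_inv]
      exact Real.log_le_sub_one_of_pos (inv_pos.2 hr.1)
    have h2 : r⁻¹ - 1 ≤ 2 * (1 - r) := by
      have hi : r⁻¹ ≤ 2 := by
        rw [inv_le_comm₀ hr.1 two_pos]
        linarith
      calc r⁻¹ - 1 = r⁻¹ * (1 - r) := by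
            have := hr.1.ne'
            field_simp
        _ ≤ 2 * (1 - r) := by
            gcongr
            linarith [hr.2]
    exact (div_le_self hlog.le hL).trans (h1.trans h2)

theorem tendsto_cutoffIntegral (hd : 1 ≤ d) (hs : 0 < s)
    (hs1 : s < 1) (hp : 1 ≤ p) (hα : α ∈ Ioo (-(s * p)) (d : ℝ))
    (hβ : β ∈ Ioo (-(s * p)) (d : ℝ)) :
    Filter.Tendsto (fun n : ℕ ↦ cutoffIntegral d s p α β ((n : ℝ) + 1)) Filter.atTop (nhds 0) := by
  set G := (d : ℝ) - α - β - s * p with hG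
  set b : ℝ → ℝ≥0∞ := fun r ↦ ENNReal.ofReal (2 ^ p) *
    ENNReal.ofReal ((1 + r ^ G) * (1 - r) ^ p) with hb
  have mb : Measurable b := by fun_prop
  have hfin : radialIntegral d s p α β b ≠ ∞ := by
    rw [hb, radialIntegral_const_mul ENNReal.ofReal_ne_top]
    exact (ENNReal.mul_lt_top ENNReal.ofReal_lt_top
      (radialIntegral_dominating_lt_top hd hs hs1 hp hα hβ)).ne
  have hlim := tendsto_lintegral_of_dominated_convergence (μ := volume.restrict (Ioo (0 : ℝ) 1))
    (F := fun (n : ℕ) r ↦ ENNReal.ofReal (min 1 (-Real.log r / ((n : ℝ) + 1)) ^ p) *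
      ENNReal.ofReal (r ^ G) *
        (ENNReal.ofReal (r ^ (s * p - 1) * (r ^ α + r ^ β)) * Phi d s p r)) (f := fun _ ↦ 0)
    (fun r ↦ b r * (ENNReal.ofReal (r ^ (s * p - 1) * (r ^ α + r ^ β)) * Phi d s p r))
    (fun n ↦ by
      refine measurable_radialIntegrand ?_
      have : Measurable fun r : ℝ ↦ min 1 (-Real.log r / ((n : ℝ) + 1)) :=
        measurable_const.min (by fun_prop)
      fun_prop)
    (fun n ↦ by
      filter_upwards [ae_restrict_mem measurableSet_Ioo] with r hr
      have hr0 := hr.1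
      have h1r : 0 < 1 - r := by linarith [hr.2]
      have hlog : 0 < -Real.log r := by linarith [Real.log_neg hr.1 hr.2]
      refine mul_le_mul_left ?_ _
      simp only [hb]
      rw [← ENNReal.ofReal_mul (by positivity), ← ENNReal.ofReal_mul (by positivity)]
      refine ENNReal.ofReal_le_ofReal ?_
      have h2 := Real.rpow_le_rpow (by positivity) (min_neg_log_le hr (L := (n : ℝ) + 1)
        (by linarith [Nat.cast_nonneg (α := ℝ) n])) (by linarith : 0 ≤ p)
      rw [Real.mul_rpow two_pos.le h1r.le] at h2
      calc _ ≤ 2 ^ p * (1 - r) ^ p * (1 + r ^ G) := by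
            gcongr
            linarith
        _ = _ := by ring)
    hfin
    (by
      filter_upwards [ae_restrict_mem measurableSet_Ioo,
        ae_lt_top (measurable_radialIntegrand mb) hfin] with r hr hlt
      have hr0 := hr.1
      have h1r : 0 < 1 - r := by linarith [hr.2]
      -- Where the integrable dominating product is finite and `b r ≠ 0`, the radial weight itself
      -- is finite; this excludes `0 * ∞` in the pointwise limit.
      have hb0 : b r ≠ 0 := by
        have h1 : 0 < (1 + r ^ G) * (1 - r) ^ p := by positivity
        have h2 : (0 : ℝ) < 2 ^ p := by positivity
        exact mul_ne_zero (ENNReal.ofReal_pos.2 h2).ne' (ENNReal.ofReal_pos.2 h1).ne'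
      have hw := (ENNReal.lt_top_of_mul_ne_top_right hlt.ne hb0).ne
      have ht : Filter.Tendsto (fun n : ℕ ↦ min 1 (-Real.log r / ((n : ℝ) + 1)) ^ p)
          Filter.atTop (nhds 0) := by
        have h1 : Filter.Tendsto (fun n : ℕ ↦ -Real.log r / ((n : ℝ) + 1))
            Filter.atTop (nhds 0) :=
          tendsto_const_nhds.div_atTop
            (Filter.tendsto_atTop_add_const_right _ 1 tendsto_natCast_atTop_atTop)
        have h2 := (tendsto_const_nhds (x := (1 : ℝ))).min h1
        rw [min_eq_right zero_le_one] at h2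
        have h3 := h2.rpow_const (p := p) (Or.inr (by linarith))
        rwa [Real.zero_rpow (by linarith : p ≠ 0)] at h3
      have ht' := ENNReal.tendsto_ofReal ht
      rw [ENNReal.ofReal_zero] at ht'
      have h4 := ENNReal.Tendsto.mul_const ht' (b := ENNReal.ofReal (r ^ G))
        (Or.inr ENNReal.ofReal_ne_top)
      rw [zero_mul] at h4
      have h5 := ENNReal.Tendsto.mul_const h4 (Or.inr hw)
      rwa [zero_mul] at h5)
  rw [lintegral_zero] at hlim
  exact hlim

/-- No constant larger than `hardyConst` is admissible, even for functions supported off zero. -/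
theorem le_hardyConst (hd : 1 ≤ d) (hs : 0 < s)
    (hs1 : s < 1) (hp : 1 ≤ p) (hα : α ∈ Ioo (-(s * p)) (d : ℝ))
    (hβ : β ∈ Ioo (-(s * p)) (d : ℝ)) (hne : s * p + α + β ≠ d) {c : ℝ≥0∞}
    (hc : ∀ u : EuclideanSpace ℝ (Fin d) → 𝕜, Continuous u → HasCompactSupport u →
      (0 : EuclideanSpace ℝ (Fin d)) ∉ tsupport u →
      c * hardyIntegral d s p α β u ≤ energy d s p α β u) :
    c ≤ hardyConst d s p α β := by
  have : Nonempty (Fin d) := ⟨⟨0, hd⟩⟩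
  set γ := ((d : ℝ) - α - β - s * p) / p with hγdef
  have hγ : γ * p = (d : ℝ) - α - β - s * p := div_mul_cancel₀ _ (by linarith)
  have hγ0 : γ ≠ 0 := by
    intro h
    rw [h, zero_mul] at hγ
    exact hne (by linarith)
  have hS0 : sphereArea d ≠ 0 := by
    unfold sphereArea
    rw [Ne, Measure.measure_univ_eq_zero]
    exact Measure.toSphere_ne_zero _
  have hC : hardyConst d s p α β ≠ ∞ := (hardyConst_lt_top hd hs hs1 hp hα hβ).ne
  rw [hardyConst_eq, ← hγdef] at hC ⊢
  set C := radialIntegral d s p α β fun r ↦ ENNReal.ofReal (|1 - r ^ γ| ^ p)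
  have hbound : ∀ l : ℝ, 0 < l → l < 1 → ∀ L : ℝ, 0 < L →
      c ≤ ENNReal.ofReal ((1 - l) ^ (1 - p)) * C +
        ENNReal.ofReal (2 * 2 ^ p) * (ENNReal.ofReal (2 * l ^ (1 - p)) *
          cutoffIntegral d s p α β L) := by
    intro l hl0 hl1 L hL
    set H := hardyIntegral d s p α β (testFun 𝕜 d γ L) with hHdef
    have hcont := continuous_testFun (𝕜 := 𝕜) (d := d) hγ0 hL
    have hsupp := hasCompactSupport_testFun (𝕜 := 𝕜) (d := d) hγ0 hL
    have hzero : (0 : EuclideanSpace ℝ (Fin d)) ∉ tsupport (testFun 𝕜 d γ L) := fun h ↦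
      zero_notMem_annulus d L (tsupport_testFun_subset hγ0 hL h)
    have hHfin : H ≠ ∞ := (hardyIntegral_lt_top_of_zero_notMem hp hcont hsupp hzero).ne
    have hHlow := le_hardyIntegral_testFun (𝕜 := 𝕜) hd hp hγ hL
    have hH0 : H ≠ 0 := by
      refine (lt_of_lt_of_le (pos_iff_ne_zero.2 ?_) hHlow).ne'
      exact mul_ne_zero (ENNReal.ofReal_pos.2 (by positivity)).ne'
        (mul_ne_zero hS0 (ENNReal.ofReal_pos.2 hL).ne')
    -- The measure of the whole annulus is controlled by the Hardy integral, uniformly in `L`, so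
    -- the estimate can be divided by `H`.
    have hV : sphereArea d * ENNReal.ofReal (2 * L) ≤ ENNReal.ofReal (2 * 2 ^ p) * H := by
      refine le_trans (le_of_eq ?_) (mul_le_mul_right hHlow _)
      have e : (2 * 2 ^ p) * (1 / 2 : ℝ) ^ p = 2 := by
        rw [mul_assoc, ← Real.mul_rpow two_pos.le (by norm_num)]
        norm_num
      rw [← mul_assoc, ← ENNReal.ofReal_mul (by positivity), e, ENNReal.ofReal_mul two_pos.le]
      ring
    have h1 := (hc _ hcont hsupp hzero).trans (energy_testFun_le hd hp hγ hγ0 hL hl0 hl1)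
    have h2 : c * H ≤ (ENNReal.ofReal ((1 - l) ^ (1 - p)) * C +
        ENNReal.ofReal (2 * 2 ^ p) * (ENNReal.ofReal (2 * l ^ (1 - p)) *
          cutoffIntegral d s p α β L)) * H := by
      refine h1.trans ((add_le_add le_rfl (mul_le_mul_left hV _)).trans_eq ?_)
      ring
    exact (ENNReal.mul_le_mul_iff_left hH0 hHfin).1 h2
  -- The order of limits matters: `L → ∞` at fixed `l` removes the cutoff term, whose coefficient
  -- `l^{1-p}` is unbounded as `l → 0` when `p > 1`; only then does `l` tend to `0`.
  have hlim : ∀ l : ℝ, 0 < l → l < 1 → c ≤ ENNReal.ofReal ((1 - l) ^ (1 - p)) * C := by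
    intro l hl0 hl1
    have ht := tendsto_cutoffIntegral hd hs hs1 hp hα hβ
    have h1 := ENNReal.Tendsto.const_mul (ENNReal.Tendsto.const_mul ht
      (a := ENNReal.ofReal (2 * l ^ (1 - p))) (Or.inr ENNReal.ofReal_ne_top))
      (a := ENNReal.ofReal (2 * 2 ^ p)) (Or.inr ENNReal.ofReal_ne_top)
    have h2 := h1.const_add (ENNReal.ofReal ((1 - l) ^ (1 - p)) * C)
    rw [mul_zero, mul_zero, add_zero] at h2
    exact ge_of_tendsto' h2 fun n ↦ hbound l hl0 hl1 _ (by positivity)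
  have ht : Filter.Tendsto (fun l : ℝ ↦ ENNReal.ofReal ((1 - l) ^ (1 - p)) * C)
      (nhdsWithin 0 (Ioi 0)) (nhds C) := by
    have h1 : Filter.Tendsto (fun l : ℝ ↦ (1 - l) ^ (1 - p)) (nhds 0) (nhds 1) := by
      have : ContinuousAt (fun l : ℝ ↦ (1 - l) ^ (1 - p)) 0 :=
        (continuousAt_const.sub continuousAt_id).rpow_const (Or.inl (by simp))
      simpa [ContinuousAt] using this
    have h2 := ENNReal.Tendsto.mul_const (ENNReal.tendsto_ofReal h1) (b := C) (Or.inr hC)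
    rw [ENNReal.ofReal_one, one_mul] at h2
    exact h2.mono_left nhdsWithin_le_nhds
  refine ge_of_tendsto ht ?_
  filter_upwards [Ioo_mem_nhdsGT (zero_lt_one' ℝ)] with l hl
  exact hlim l hl.1 hl.2

end Optimality

end FracHardy

theorem theorem1p5 (𝕜 : Type*) [RCLike 𝕜] (d : ℕ) (hd : 1 ≤ d) (s p α β : ℝ)
    (hs0 : 0 < s) (hs1 : s < 1) (hp : 1 ≤ p)
    (hα : α ∈ Ioo (-(s * p)) (d : ℝ)) (hβ : β ∈ Ioo (-(s * p)) (d : ℝ))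
    (hαβ : α + β ∈ Ioo (-(s * p)) (d : ℝ)) :
    FracHardy.hardyConst d s p α β < ∞ ∧
    (s * p + α + β < d →
      IsGreatest {c : ℝ≥0∞ | ∀ u : EuclideanSpace ℝ (Fin d) → 𝕜,
          Continuous u → HasCompactSupport u →
          c * FracHardy.hardyIntegral d s p α β u ≤ FracHardy.energy d s p α β u}
        (FracHardy.hardyConst d s p α β)) ∧
    (d < s * p + α + β →
      IsGreatest {c : ℝ≥0∞ | ∀ u : EuclideanSpace ℝ (Fin d) → 𝕜,
          Continuous u → HasCompactSupport u → (0 : EuclideanSpace ℝ (Fin d)) ∉ tsupport u →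
          c * FracHardy.hardyIntegral d s p α β u ≤ FracHardy.energy d s p α β u}
        (FracHardy.hardyConst d s p α β)) := by
  have hC := FracHardy.hardyConst_lt_top hd hs0 hs1 hp hα hβ
  refine ⟨hC, fun h ↦ ⟨fun u hu hc ↦ ?_, fun c hc ↦ ?_⟩, fun h ↦ ⟨fun u hu hc h0 ↦ ?_,
    fun c hc ↦ ?_⟩⟩
  · exact FracHardy.hardyConst_mul_hardyIntegral_le_energy hd hp h.ne hu
      (FracHardy.hardyIntegral_lt_top_of_lt hd hp h hu hc) hC
  -- A constant valid on the larger class is in particular valid for functions supported away from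
  -- the origin.
  · exact FracHardy.le_hardyConst (𝕜 := 𝕜) hd hs0 hs1 hp hα hβ h.ne fun u hu hcs _ ↦ hc u hu hcs
  · exact FracHardy.hardyConst_mul_hardyIntegral_le_energy hd hp h.ne' hu
      (FracHardy.hardyIntegral_lt_top_of_zero_notMem hp hu hc h0) hC
  · exact FracHardy.le_hardyConst hd hs0 hs1 hp hα hβ h.ne' hc
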